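/- **Theorem.** Let $n\ge 1$, let $F^2(H_n)$ be the full Fock space with orthonormal basis $\{e_\alpha\}$ indexed by the words $\alpha$ in $g_1,\dots,g_n$, and let $S_i e_\alpha=e_{g_i\alpha}$, $R_i e_\alpha=e_{\alpha g_i}$ be the left and right creation operators. Let $F_n^\infty$ be the WOT-closed algebra generated by $S_1,\dots,S_n$ and $I$, and let $J\ne F_n^\infty$ be a WOT-closed two-sided ideal of $F_n^\infty$. Put $\mathcal M_J=\overline{JF^2(H_n)}$, $\mathcal N_J=F^2(H_n)\ominus\mathcal M_J$, $B_i=P_{\mathcal N_J}S_i|_{\mathcal N_J}$ and $W_i=P_{\mathcal N_J}R_i|_{\mathcal N_J}$. Let $T=[T_1,\dots,T_n]$ be a row contraction on a complex Hilbert space $\mathcal H$ (that is, $\sum_i T_iT_i^*\le I$), and for $\alpha=g_{i_1}\cdots g_{i_k}$ write $T_\alpha=T_{i_1}\cdots T_{i_k}$ and $|\alpha|=k$. Assume that $T$ is completely non-coisometric (there is no $h\ne0$ with $\sum_{|\alpha|=k}\|T_\alpha^*h\|^2=\|h\|^2$ for all $k\ge1$) and $J$-constrained, i.e. for every $f\in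 J$ with Fourier coefficients $a_\alpha=\langle f(1),e_\alpha\rangle$, $$f(T_1,\dots,T_n):=\text{SOT-}\lim_{r\to1^-}\sum_{k=0}^\infty\sum_{|\alpha|=k}r^{|\alpha|}a_\alpha T_\alpha=0 .$$ Let $\Delta_T=(I-\sum_iT_iT_i^*)^{1/2}$ on $\mathcal H$ and $\Delta_{T^*}=(I-T^*T)^{1/2}$ on $\mathcal H^{(n)}$, with $\mathcal D_T=\overline{\Delta_T\mathcal H}$ and $\mathcal D_{T^*}=\overline{\Delta_{T^*}\mathcal H^{(n)}}$. (i) There is a unique bounded operator $K_T:\mathcal H\to F^2(H_n)\otimes\mathcal D_T$ with $K_Th=\sum_\alpha e_\alpha\otimes\Delta_TT_\alpha^*h$ for all $h\in\mathcal H$. Put $K_{J,T}=(P_{\mathcal N_J}\otimes I_{\mathcal D_T})K_T:\mathcal H\to\mathcal N_J\otimes\mathcal D_T$ (the constrained Poisson kernel). (ii) There is a unique bounded operator $\Theta_{J,T}:\mathcal N_J\otimes\mathcal D_{T^*}\to\mathcal N_J\otimes\mathcal D_T$ (the constrained characteristic function) that satisfies $\Theta_{J,T}(B_i\otimes I)=(B_i\otimes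 I)\Theta_{J,T}$ for all $i$ and has the formal Fourier representation $$-I_{\mathcal N_J}\otimes T+(I_{\mathcal N_J}\otimes\Delta_T)\Big(I-\sum_{i=1}^nW_i\otimes T_i^*\Big)^{-1}[W_1\otimes I_{\mathcal H},\dots,W_n\otimes I_{\mathcal H}](I_{\mathcal N_J}\otimes\Delta_{T^*}),$$ meaning that, with the formal inverse expanded as $\sum_{k\ge0}(\sum_iW_i\otimes T_i^*)^k$, the resulting series converges to $\Theta_{J,T}x$ at every vector $x=P_{\mathcal N_J}e_\gamma\otimes d$ with $\gamma$ a word and $d\in\mathcal D_{T^*}$. (iii) These operators satisfy $$I_{\mathcal N_J\otimes\mathcal D_T}-\Theta_{J,T}\Theta_{J,T}^*=K_{J,T}K_{J,T}^* .$$ -/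

import Mathlib

open Filter Topology
open scoped TensorProduct

noncomputable section

namespace NCFock

/-! ### Hilbert tensor products -/

section Tensor

variable {E F E' F' : Type*}
  [NormedAddCommGroup E] [InnerProductSpace ℂ E] [NormedAddCommGroup F] [InnerProductSpace ℂ F]
  [NormedAddCommGroup E'] [InnerProductSpace ℂ E'] [NormedAddCommGroup F'] [InnerProductSpace ℂ F']

/-- The Hilbert space tensor product: the completion of the algebraic tensor product for the
inner product with `⟪a ⊗ b, c ⊗ d⟫ = ⟪a, c⟫ * ⟪b, d⟫`. -/
def HTensor (E F : Type*) [NormedAddCommGroup E] [InnerProductSpace ℂ E]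
    [NormedAddCommGroup F] [InnerProductSpace ℂ F] : Type _ :=
  UniformSpace.Completion (E ⊗[ℂ] F)

instance : NormedAddCommGroup (HTensor E F) :=
  inferInstanceAs (NormedAddCommGroup (UniformSpace.Completion (E ⊗[ℂ] F)))

instance : InnerProductSpace ℂ (HTensor E F) :=
  inferInstanceAs (InnerProductSpace ℂ (UniformSpace.Completion (E ⊗[ℂ] F)))

instance : CompleteSpace (HTensor E F) :=
  inferInstanceAs (CompleteSpace (UniformSpace.Completion (E ⊗[ℂ] F)))

/-- The elementary tensor `x ⊗ y`. -/
def tmul (x : E) (y : F) : HTensor E F :=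
  ((x ⊗ₜ[ℂ] y : E ⊗[ℂ] F) : UniformSpace.Completion (E ⊗[ℂ] F))

/-- The bounded operator `A ⊗ B` between Hilbert tensor products. -/
def tmap (A : E →L[ℂ] E') (B : F →L[ℂ] F') : HTensor E F →L[ℂ] HTensor E' F' :=
  (TensorProduct.mapL A B).completion

theorem tmap_tmul (A : E →L[ℂ] E') (B : F →L[ℂ] F') (x : E) (y : F) :
    tmap A B (tmul x y) = tmul (A x) (B y) :=
  (TensorProduct.mapL A B).completion_apply_coe (x ⊗ₜ[ℂ] y)

theorem inner_tmul (x x' : E) (y y' : F) :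
    inner ℂ (tmul x y) (tmul x' y') = inner ℂ x x' * inner ℂ y y' :=
  (UniformSpace.Completion.inner_coe _ _).trans (TensorProduct.inner_tmul ..)

end Tensor

/-! ### The full Fock space and the creation operators -/

/-- The full Fock space `F²(H_n)`, with its orthonormal basis indexed by the words in
`n` letters (the unital free semigroup on `n` generators). -/
abbrev Fock (n : ℕ) : Type := lp (fun _ : FreeMonoid (Fin n) => ℂ) 2

open Classical in
/-- The basis vector `e_α = e_{i₁} ⊗ ⋯ ⊗ e_{iₖ}` for the word `α = g_{i₁} ⋯ g_{iₖ}`;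
the empty word gives the vacuum vector. -/
def e {n : ℕ} (α : FreeMonoid (Fin n)) : Fock n := lp.single 2 α (1 : ℂ)

theorem orthonormal_e (n : ℕ) : Orthonormal ℂ (e : FreeMonoid (Fin n) → Fock n) := by
  classical
  rw [orthonormal_iff_ite]
  intro α β
  simp only [e, lp.inner_single_left, lp.single_apply]
  by_cases h : α = β
  · subst h; simp
  · simp [h]

theorem orthonormal_left {n : ℕ} (i : Fin n) :
    Orthonormal ℂ (fun α : FreeMonoid (Fin n) => (e (FreeMonoid.of i * α) : Fock n)) :=
  (orthonormal_e n).comp _ (mul_right_injective (FreeMonoid.of i))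

theorem orthonormal_right {n : ℕ} (i : Fin n) :
    Orthonormal ℂ (fun α : FreeMonoid (Fin n) => (e (α * FreeMonoid.of i) : Fock n)) :=
  (orthonormal_e n).comp _ (mul_left_injective (FreeMonoid.of i))

/-- The left creation operator `S_i φ = e_i ⊗ φ`, i.e. the isometry `e_α ↦ e_{g_i α}`. -/
def S {n : ℕ} (i : Fin n) : Fock n →L[ℂ] Fock n :=
  (orthonormal_left i).orthogonalFamily.linearIsometry.toContinuousLinearMap

/-- The right creation operator `R_i φ = φ ⊗ e_i`, i.e. the isometry `e_α ↦ e_{α g_i}`. -/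
def R {n : ℕ} (i : Fin n) : Fock n →L[ℂ] Fock n :=
  (orthonormal_right i).orthogonalFamily.linearIsometry.toContinuousLinearMap

theorem S_e {n : ℕ} (i : Fin n) (α : FreeMonoid (Fin n)) :
    S i (e α) = e (FreeMonoid.of i * α) := by
  classical
  have h := (orthonormal_left i).orthogonalFamily.linearIsometry_apply_single (i := α) (1 : ℂ)
  simp only [LinearIsometry.toSpanSingleton_apply, one_smul] at h
  simpa only [S, e, LinearIsometry.coe_toContinuousLinearMap] using h

theorem R_e {n : ℕ} (i : Fin n) (α : FreeMonoid (Fin n)) :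
    R i (e α) = e (α * FreeMonoid.of i) := by
  classical
  have h := (orthonormal_right i).orthogonalFamily.linearIsometry_apply_single (i := α) (1 : ℂ)
  simp only [LinearIsometry.toSpanSingleton_apply, one_smul] at h
  simpa only [R, e, LinearIsometry.coe_toContinuousLinearMap] using h

/-! ### The noncommutative analytic Toeplitz algebra and its WOT-closed ideals -/

/-- The noncommutative analytic Toeplitz algebra `F_n^∞`: the closure, in the weak operator
topology, of the algebra generated by `S_1, …, S_n` and the identity. -/
def toeplitz (n : ℕ) : Set (Fock n →L[ℂ] Fock n) :=
  {f | ContinuousLinearMapWOT.ofCLM f ∈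
    closure (ContinuousLinearMapWOT.ofCLM ''
      (Algebra.adjoin ℂ (Set.range (S : Fin n → Fock n →L[ℂ] Fock n)) :
        Set (Fock n →L[ℂ] Fock n)))}

/-- `J` is a WOT-closed two-sided ideal of `F_n^∞`. -/
structure IsWOTClosedIdeal {n : ℕ} (J : Submodule ℂ (Fock n →L[ℂ] Fock n)) : Prop where
  subset_toeplitz : (J : Set (Fock n →L[ℂ] Fock n)) ⊆ toeplitz n
  mul_mem_left : ∀ a ∈ toeplitz n, ∀ f ∈ J, a * f ∈ J
  mul_mem_right : ∀ a ∈ toeplitz n, ∀ f ∈ J, f * a ∈ J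
  isClosed : IsClosed (ContinuousLinearMapWOT.ofCLM '' (J : Set (Fock n →L[ℂ] Fock n)))

/-- The closed subspace `M_J` generated by `J F²(H_n)`. -/
def MJ {n : ℕ} (J : Submodule ℂ (Fock n →L[ℂ] Fock n)) : Submodule ℂ (Fock n) :=
  (Submodule.span ℂ {x | ∃ f ∈ J, ∃ ξ : Fock n, f ξ = x}).topologicalClosure

/-- `N_J = F²(H_n) ⊖ M_J`. -/
abbrev NJ {n : ℕ} (J : Submodule ℂ (Fock n →L[ℂ] Fock n)) : Submodule ℂ (Fock n) := (MJ J)ᗮ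

/-- The orthogonal projection of `F²(H_n)` onto `N_J`. -/
def PJ {n : ℕ} (J : Submodule ℂ (Fock n →L[ℂ] Fock n)) : Fock n →L[ℂ] NJ J :=
  (NJ J).orthogonalProjectionOnto

/-- The constrained left creation operator `B_i = P_{N_J} S_i |_{N_J}`. -/
def B {n : ℕ} (J : Submodule ℂ (Fock n →L[ℂ] Fock n)) (i : Fin n) : NJ J →L[ℂ] NJ J :=
  PJ J ∘L S i ∘L (NJ J).subtypeL

/-- The constrained right creation operator `W_i = P_{N_J} R_i |_{N_J}`. -/
def W {n : ℕ} (J : Submodule ℂ (Fock n →L[ℂ] Fock n)) (i : Fin n) : NJ J →L[ℂ] NJ J :=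
  PJ J ∘L R i ∘L (NJ J).subtypeL

/-! ### Row contractions -/

section Row

variable {n : ℕ} {H : Type*} [NormedAddCommGroup H] [InnerProductSpace ℂ H]

/-- The direct sum `H^(n)` of `n` copies of `H`. -/
abbrev Copies (n : ℕ) (H : Type*) [NormedAddCommGroup H] : Type _ := PiLp 2 (fun _ : Fin n => H)

/-- The `i`-th coordinate map `H^(n) → H`. -/
def coord (i : Fin n) : Copies n H →L[ℂ] H := PiLp.proj (𝕜 := ℂ) 2 (fun _ : Fin n => H) i

/-- The row operator `T = [T_1, …, T_n] : H^(n) → H`, `(h_i) ↦ ∑ T_i h_i`. -/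
def row (T : Fin n → H →L[ℂ] H) : Copies n H →L[ℂ] H := ∑ i, T i ∘L coord i

/-- `T_α = T_{i₁} ⋯ T_{iₖ}` for `α = g_{i₁} ⋯ g_{iₖ}`, and `I` for the empty word. -/
def wordOp (T : Fin n → H →L[ℂ] H) (α : FreeMonoid (Fin n)) : H →L[ℂ] H := FreeMonoid.lift T α

/-- The words of length `k`, enumerated by their letters. -/
def word {k : ℕ} (w : Fin k → Fin n) : FreeMonoid (Fin n) := FreeMonoid.ofList (List.ofFn w)

/-- `f(T_1, …, T_n) = A` in the `F_n^∞`-functional calculus: with the Fourier coefficients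
`a_α = ⟪e_α, f 1⟫` of `f`, the operators `∑ₖ ∑_{|α| = k} r^|α| a_α T_α` converge to `A` in the strong
operator topology as `r → 1`, `r < 1`. -/
def HasFunctionalCalculus (T : Fin n → H →L[ℂ] H) (f : Fock n →L[ℂ] Fock n) (A : H →L[ℂ] H) :
    Prop :=
  ∀ h : H, Tendsto
    (fun r : ℝ => (∑' k : ℕ, ∑ w : Fin k → Fin n,
      ((r : ℂ) ^ k * inner ℂ (e (word w)) (f (e 1))) • wordOp T (word w)) h)
    (𝓝[<] 1) (𝓝 (A h))

/-- `T` is `J`-constrained: `f(T_1, …, T_n) = 0` for all `f ∈ J`. -/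
def IsConstrained (J : Submodule ℂ (Fock n →L[ℂ] Fock n)) (T : Fin n → H →L[ℂ] H) : Prop :=
  ∀ f ∈ J, HasFunctionalCalculus T f 0

variable [CompleteSpace H]

/-- `T_1 T_1^* + ⋯ + T_n T_n^* ≤ I`. -/
def IsRowContraction (T : Fin n → H →L[ℂ] H) : Prop :=
  ∑ i, T i ∘L (T i).adjoint ≤ 1

/-- `T` is completely non-coisometric: there is no `h ≠ 0` with
`∑_{|α| = k} ‖T_α^* h‖² = ‖h‖²` for all `k = 1, 2, …`. -/
def IsCNC (T : Fin n → H →L[ℂ] H) : Prop :=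
  ¬ ∃ h : H, h ≠ 0 ∧ ∀ k : ℕ, 1 ≤ k →
    ∑ w : Fin k → Fin n, ‖(wordOp T (word w)).adjoint h‖ ^ 2 = ‖h‖ ^ 2

/-- The defect operator `Δ_T = (I - ∑ T_i T_i^*)^{1/2}` on `H`. -/
def defect (T : Fin n → H →L[ℂ] H) : H →L[ℂ] H :=
  CFC.sqrt (1 - ∑ i, T i ∘L (T i).adjoint)

/-- The defect operator `Δ_{T^*} = (I - T^* T)^{1/2}` on `H^(n)`. -/
def defectStar (T : Fin n → H →L[ℂ] H) : Copies n H →L[ℂ] Copies n H :=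
  CFC.sqrt (1 - (row T).adjoint ∘L row T)

/-- The defect space `D_T`, the closure of the range of `Δ_T`. -/
abbrev DT (T : Fin n → H →L[ℂ] H) : Submodule ℂ H :=
  (LinearMap.range (defect T).toLinearMap).topologicalClosure

/-- The defect space `D_{T^*}`, the closure of the range of `Δ_{T^*}`. -/
abbrev DTstar (T : Fin n → H →L[ℂ] H) : Submodule ℂ (Copies n H) :=
  (LinearMap.range (defectStar T).toLinearMap).topologicalClosure

/-- `Δ_T` as an operator from `H` to `D_T`. -/
def defectTo (T : Fin n → H →L[ℂ] H) : H →L[ℂ] DT T :=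
  (defect T).codRestrict (DT T)
    (fun h => Submodule.le_topologicalClosure _ (LinearMap.mem_range_self _ h))

/-- `K` is the Poisson kernel `K_T : H → F²(H_n) ⊗ D_T`, that is,
`K h = ∑_α e_α ⊗ Δ_T T_α^* h` for all `h`. -/
def IsPoissonKernel (T : Fin n → H →L[ℂ] H) (K : H →L[ℂ] HTensor (Fock n) (DT T)) : Prop :=
  ∀ h : H, HasSum
    (fun α : FreeMonoid (Fin n) => tmul (e α) (defectTo T ((wordOp T α).adjoint h))) (K h)

/-- The constrained Poisson kernel `K_{J,T} = (P_{N_J} ⊗ I) K_T : H → N_J ⊗ D_T`. -/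
def constrainedKernel (J : Submodule ℂ (Fock n →L[ℂ] Fock n)) (T : Fin n → H →L[ℂ] H)
    (K : H →L[ℂ] HTensor (Fock n) (DT T)) : H →L[ℂ] HTensor (NJ J) (DT T) :=
  tmap (PJ J) (ContinuousLinearMap.id ℂ (DT T)) ∘L K

/-- `∑ W_i ⊗ T_i^*` on `N_J ⊗ H`. -/
def sumWT (J : Submodule ℂ (Fock n →L[ℂ] Fock n)) (T : Fin n → H →L[ℂ] H) :
    HTensor (NJ J) H →L[ℂ] HTensor (NJ J) H :=
  ∑ i, tmap (W J i) (T i).adjoint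

/-- The row operator `[W_1 ⊗ I_H, …, W_n ⊗ I_H] : N_J ⊗ H^(n) → N_J ⊗ H`. -/
def rowW (J : Submodule ℂ (Fock n →L[ℂ] Fock n)) (H : Type*) [NormedAddCommGroup H]
    [InnerProductSpace ℂ H] : HTensor (NJ J) (Copies n H) →L[ℂ] HTensor (NJ J) H :=
  ∑ i, tmap (W J i) (coord i)

/-- The homogeneous part of degree `k + 1` of the formal Fourier representation
`(I ⊗ Δ_T) (I - ∑ W_i ⊗ T_i^*)⁻¹ [W_1 ⊗ I, …, W_n ⊗ I] (I ⊗ Δ_{T^*})`, the formal inverse being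
the series `∑ₖ (∑ W_i ⊗ T_i^*)^k`. -/
def fourierPart (J : Submodule ℂ (Fock n →L[ℂ] Fock n)) (T : Fin n → H →L[ℂ] H) (k : ℕ) :
    HTensor (NJ J) (Copies n H) →L[ℂ] HTensor (NJ J) H :=
  tmap (ContinuousLinearMap.id ℂ (NJ J)) (defect T) ∘L (sumWT J T ^ k) ∘L rowW J H ∘L
    tmap (ContinuousLinearMap.id ℂ (NJ J)) (defectStar T)

/-- `Θ` is the constrained characteristic function `Θ_{J,T} : N_J ⊗ D_{T^*} → N_J ⊗ D_T`: the
bounded operator that is multi-analytic with respect to `B_1, …, B_n` and has the formal Fourier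
representation
`-I ⊗ T + (I ⊗ Δ_T) (I - ∑ W_i ⊗ T_i^*)⁻¹ [W_1 ⊗ I, …, W_n ⊗ I] (I ⊗ Δ_{T^*})`,
i.e. acts as this series on the polynomials, which are spanned by the vectors
`(P_{N_J} e_γ) ⊗ d` with `γ` a word and `d ∈ D_{T^*}`. The series takes values in `N_J ⊗ H`, in which
`N_J ⊗ D_T` is included. -/
structure IsCharacteristicFunction (J : Submodule ℂ (Fock n →L[ℂ] Fock n))
    (T : Fin n → H →L[ℂ] H)
    (Θ : HTensor (NJ J) (DTstar T) →L[ℂ] HTensor (NJ J) (DT T)) : Prop where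
  multiAnalytic : ∀ i : Fin n,
    Θ ∘L tmap (B J i) (ContinuousLinearMap.id ℂ (DTstar T)) =
      tmap (B J i) (ContinuousLinearMap.id ℂ (DT T)) ∘L Θ
  fourier : ∀ (γ : FreeMonoid (Fin n)) (d : DTstar T), ∃ s : HTensor (NJ J) H,
    HasSum (fun k : ℕ => fourierPart J T k (tmul (PJ J (e γ)) (d : Copies n H))) s ∧
    tmap (ContinuousLinearMap.id ℂ (NJ J)) (DT T).subtypeL (Θ (tmul (PJ J (e γ)) d)) =
      -tmap (ContinuousLinearMap.id ℂ (NJ J)) (row T) (tmul (PJ J (e γ)) (d : Copies n H)) + s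

end Row

end NCFock

end

/-!
The characteristic function is the transfer function of a unitary colligation. Write
`Z = [R_1 ⊗ I, …, R_n ⊗ I]`, an isometry `F²(H_n) ⊗ H^(n) → F²(H_n) ⊗ H` whose range is the orthogonal
complement of `e_1 ⊗ H` (`rowR_comp_adjoint`, where `e_1` is the vacuum). The Halmos matrix
`[[T, Δ_T], [Δ_{T^*}, -T^*]]` is isometric on `H^(n) ⊕ D_T`
(`IsRowContraction.isIsometricColligation`); this needs `T^* Δ_T = Δ_{T^*} T^*`, which follows from
polynomial approximation of the square root (`comp_cfc_of_intertwine`).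

Boundedness is proved for the adjoint of the characteristic function, because on a polynomial `x` the
series for `y = (I - T Z^*)⁻¹ Δ_T x` is finite: `T Z^*` lowers the length of words. With
`Θ^* x = Δ_{T^*} Z^* y - T^* x` the colligation identity reads
`‖y‖² + ‖Θ^* x‖² = ‖Z^* y‖² + ‖x‖²`, and `‖y‖² - ‖Z^* y‖²` is the squared norm of the vacuum coordinate
of `y`, which is `∑ T_α Δ_T x_α = K_T^* x`. Hence `‖x‖² = ‖Θ^* x‖² + ‖K_T^* x‖²`
(`IsIsometricColligation.norm_sq`). So both operators extend continuously from the dense subspace of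
polynomials, and polarization gives `I - Θ Θ^* = K_T K_T^*`. The Fourier series of `Θ` at `e_γ ⊗ d`
converges in norm because its terms are homogeneous of different degrees, and they are the homogeneous
parts of one vector of `F²(H_n) ⊗ D_T` (`hasSum_of_coef_eq`, `exists_transferFunction`).

To pass to `N_J`, the matrix entries of `Θ` and the operators `R_i` commute with `S_1, …, S_n`, so
with all of `F_n^∞`, and therefore leave `M_J = [J F²(H_n)]` invariant
(`commute_of_mem_toeplitz`, `IsWOTClosedIdeal.commutant_mem_MJ`). With `P = P_{N_J} ⊗ I` this gives
`Θ_J P = P Θ` for the compression `Θ_J` of `Θ` (`IsWOTClosedIdeal.compress_comp`); since `P` is a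
coisometry, every assertion about `Θ` descends to `Θ_J`. The vectors `P_{N_J} e_γ ⊗ d` are total,
whence uniqueness.
-/

noncomputable section

namespace NCFock

/-! ### Hilbert tensor products of operators -/

section TensorOps

variable {E F G E' F' E'' F'' : Type*}
  [NormedAddCommGroup E] [InnerProductSpace ℂ E] [NormedAddCommGroup F] [InnerProductSpace ℂ F]
  [NormedAddCommGroup G] [InnerProductSpace ℂ G]
  [NormedAddCommGroup E'] [InnerProductSpace ℂ E'] [NormedAddCommGroup F'] [InnerProductSpace ℂ F']
  [NormedAddCommGroup E''] [InnerProductSpace ℂ E'']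
  [NormedAddCommGroup F''] [InnerProductSpace ℂ F'']

/-- The operator `y ↦ x ⊗ y`. -/
def tmulLeft (F : Type*) [NormedAddCommGroup F] [InnerProductSpace ℂ F] (x : E) :
    F →L[ℂ] HTensor E F :=
  (UniformSpace.Completion.toComplL : E ⊗[ℂ] F →L[ℂ] _) ∘L TensorProduct.mkL ℂ E F x

@[simp] theorem tmulLeft_apply (x : E) (y : F) : tmulLeft F x y = tmul x y := rfl

/-- The operator `x ↦ x ⊗ y`. -/
def tmulRight (E : Type*) [NormedAddCommGroup E] [InnerProductSpace ℂ E] (y : F) :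
    E →L[ℂ] HTensor E F :=
  (UniformSpace.Completion.toComplL : E ⊗[ℂ] F →L[ℂ] _) ∘L (TensorProduct.mkL ℂ E F).flip y

@[simp] theorem tmulRight_apply (x : E) (y : F) : tmulRight E y x = tmul x y := rfl

theorem tmul_add (x : E) (y y' : F) : tmul x (y + y') = tmul x y + tmul x y' :=
  map_add (tmulLeft F x) y y'

@[simp] theorem tmul_zero (x : E) : tmul x (0 : F) = 0 := map_zero (tmulLeft F x)

@[simp] theorem zero_tmul (y : F) : tmul (0 : E) y = 0 := map_zero (tmulRight E y)

theorem clm_ext_tmul {f g : HTensor E F →L[ℂ] G}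
    (h : ∀ x y, f (tmul x y) = g (tmul x y)) : f = g := by
  have key : ∀ t : E ⊗[ℂ] F, f (t : UniformSpace.Completion (E ⊗[ℂ] F)) =
      g (t : UniformSpace.Completion (E ⊗[ℂ] F)) := by
    intro t
    induction t using TensorProduct.induction_on with
    | zero => rw [UniformSpace.Completion.coe_zero]; exact (map_zero f).trans (map_zero g).symm
    | tmul x y => exact h x y
    | add a b ha hb =>
      rw [UniformSpace.Completion.coe_add]
      exact (map_add f _ _).trans ((congrArg₂ _ ha hb).trans (map_add g _ _).symm)
  refine ContinuousLinearMap.ext fun u => ?_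
  exact congrFun (UniformSpace.Completion.denseRange_coe.equalizer f.continuous g.continuous
    (funext key)) u

theorem ext_inner_tmul {u v : HTensor E F}
    (h : ∀ x y, inner ℂ u (tmul x y) = inner ℂ v (tmul x y)) : u = v := by
  have : innerSL ℂ u = innerSL ℂ v := clm_ext_tmul fun x y => by simpa using h x y
  exact ext_inner_right ℂ fun w => by simpa using DFunLike.congr_fun this w

theorem tmap_comp (A' : E' →L[ℂ] E'') (B' : F' →L[ℂ] F'') (A : E →L[ℂ] E') (B : F →L[ℂ] F') :
    tmap A' B' ∘L tmap A B = tmap (A' ∘L A) (B' ∘L B) :=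
  clm_ext_tmul fun x y => by simp [tmap_tmul]

@[simp] theorem tmap_id : tmap (.id ℂ E) (.id ℂ F) = .id ℂ (HTensor E F) :=
  clm_ext_tmul fun x y => by simp [tmap_tmul]

theorem tmap_add_right (A : E →L[ℂ] E') (B B' : F →L[ℂ] F') :
    tmap A (B + B') = tmap A B + tmap A B' :=
  clm_ext_tmul fun x y => by simp [tmap_tmul, tmul_add]

theorem tmap_id_right_comm (A : E →L[ℂ] E') (B : F →L[ℂ] F') (u : HTensor E F) :
    tmap A (.id ℂ F') (tmap (.id ℂ E) B u) = tmap (.id ℂ E') B (tmap A (.id ℂ F) u) := by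
  simp only [← ContinuousLinearMap.comp_apply, tmap_comp, ContinuousLinearMap.id_comp,
    ContinuousLinearMap.comp_id]

theorem adjoint_tmap [CompleteSpace E] [CompleteSpace E'] [CompleteSpace F] [CompleteSpace F']
    (A : E →L[ℂ] E') (B : F →L[ℂ] F') : (tmap A B).adjoint = tmap A.adjoint B.adjoint := by
  refine clm_ext_tmul fun x y => ext_inner_tmul fun x' y' => ?_
  rw [ContinuousLinearMap.adjoint_inner_left, tmap_tmul, tmap_tmul, inner_tmul, inner_tmul,
    ContinuousLinearMap.adjoint_inner_left, ContinuousLinearMap.adjoint_inner_left]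

end TensorOps

/-! ### Coordinates in `F²(H_n) ⊗ D` -/

section Coef

variable {n : ℕ} {D D' G : Type*} [NormedAddCommGroup D] [InnerProductSpace ℂ D]
  [NormedAddCommGroup D'] [InnerProductSpace ℂ D'] [NormedAddCommGroup G] [InnerProductSpace ℂ G]

theorem inner_e (α β : FreeMonoid (Fin n)) [Decidable (α = β)] :
    inner ℂ (e α : Fock n) (e β) = if α = β then 1 else 0 := by
  classical
  rw [orthonormal_iff_ite.mp (orthonormal_e n) α β]
  congr

theorem hasSum_smul_e (x : Fock n) : HasSum (fun α => x α • (e α : Fock n)) x := by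
  classical
  convert lp.hasSum_single (p := 2) (by simp) x using 2 with α
  rw [e, ← lp.single_smul, smul_eq_mul, mul_one]

theorem clm_ext_e {f g : Fock n →L[ℂ] G} (h : ∀ α, f (e α) = g (e α)) : f = g := by
  refine ContinuousLinearMap.ext fun x => ?_
  have h1 := (hasSum_smul_e x).mapL f
  have h2 := (hasSum_smul_e x).mapL g
  simp only [map_smul, h] at h1 h2
  exact h1.unique h2

theorem clm_ext_tmul_e {f g : HTensor (Fock n) D →L[ℂ] G}
    (h : ∀ α d, f (tmul (e α) d) = g (tmul (e α) d)) : f = g := by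
  refine clm_ext_tmul fun x y => ?_
  have : f ∘L tmulRight (Fock n) y = g ∘L tmulRight (Fock n) y := clm_ext_e fun α => h α y
  exact DFunLike.congr_fun this x

theorem norm_tmul_e (α : FreeMonoid (Fin n)) (d : D) : ‖tmul (e α : Fock n) d‖ = ‖d‖ := by
  classical
  have h := inner_tmul (e α : Fock n) (e α) d d
  rw [inner_e, if_pos rfl, one_mul, inner_self_eq_norm_sq_to_K, inner_self_eq_norm_sq_to_K] at h
  have h' : ‖tmul (e α : Fock n) d‖ ^ 2 = ‖d‖ ^ 2 := by exact_mod_cast h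
  exact (pow_left_inj₀ (norm_nonneg _) (norm_nonneg _) two_ne_zero).mp h'

variable [CompleteSpace D] [CompleteSpace D'] [CompleteSpace G]

/-- The coordinate of a vector of `F²(H_n) ⊗ D = ⨁_α e_α ⊗ D` at the word `α`. -/
def coef (α : FreeMonoid (Fin n)) : HTensor (Fock n) D →L[ℂ] D := (tmulLeft D (e α)).adjoint

theorem inner_coef_right (α : FreeMonoid (Fin n)) (d : D) (u : HTensor (Fock n) D) :
    inner ℂ d (coef α u) = inner ℂ (tmul (e α) d) u := by
  rw [coef, ContinuousLinearMap.adjoint_inner_right, tmulLeft_apply]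

theorem coef_tmul (α β : FreeMonoid (Fin n)) (d : D) [Decidable (α = β)] :
    coef α (tmul (e β) d) = if α = β then d else 0 := by
  refine ext_inner_left ℂ fun d' => ?_
  rw [inner_coef_right, inner_tmul, inner_e]
  split_ifs <;> simp

theorem ext_coef {u v : HTensor (Fock n) D} (h : ∀ α, coef α u = coef α v) : u = v := by
  have : innerSL ℂ u = innerSL ℂ v := clm_ext_tmul_e fun α d => by
    have := congrArg (fun w => (starRingEnd ℂ) (inner ℂ d w)) (h α)
    simpa [inner_coef_right] using this
  exact ext_inner_right ℂ fun w => by simpa using DFunLike.congr_fun this w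

/-- `F²(H_n) ⊗ D` is the orthogonal direct sum of the copies `e_α ⊗ D` of `D`. -/
theorem hasSum_coef (u : HTensor (Fock n) D) :
    HasSum (fun α => tmul (e α) (coef α u)) u := by
  classical
  let V (α : FreeMonoid (Fin n)) : D →ₗᵢ[ℂ] HTensor (Fock n) D :=
    ⟨(tmulLeft D (e α)).toLinearMap, norm_tmul_e α⟩
  have hV : OrthogonalFamily ℂ (fun _ => D) V := fun α β hαβ d d' => by
    change inner ℂ (tmul (e α) d) (tmul (e β) d') = 0
    rw [inner_tmul, inner_e, if_neg hαβ, zero_mul]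
  have hS : IsHilbertSum ℂ (fun _ => D) V := by
    refine IsHilbertSum.mk hV ?_
    rw [top_le_iff, Submodule.topologicalClosure_eq_top_iff, Submodule.eq_bot_iff]
    intro w hw
    refine ext_coef fun α => ?_
    rw [map_zero]
    refine ext_inner_left ℂ fun d => ?_
    rw [inner_coef_right, inner_zero_right]
    exact (Submodule.mem_orthogonal _ _).mp hw _
      (Submodule.mem_iSup_of_mem α (LinearMap.mem_range.mpr ⟨d, rfl⟩))
  have h1 := hS.hasSum_linearIsometryEquiv_symm (hS.linearIsometryEquiv u)
  rw [LinearIsometryEquiv.symm_apply_apply] at h1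
  have h2 : ∀ α, hS.linearIsometryEquiv u α = coef α u := fun α => by
    have h3 := h1.mapL (coef α)
    have h4 := hasSum_ite_eq α (hS.linearIsometryEquiv u α)
    refine h4.unique ?_
    convert h3 using 2 with β
    change _ = coef α (tmul (e β) _)
    rw [coef_tmul]
    by_cases hβ : β = α
    · subst hβ; simp
    · rw [if_neg hβ, if_neg (Ne.symm hβ)]
  simp only [h2] at h1
  exact h1

theorem coef_tmap_id (A : D →L[ℂ] D') (α : FreeMonoid (Fin n)) (u : HTensor (Fock n) D) :
    coef α (tmap (.id ℂ (Fock n)) A u) = A (coef α u) := by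
  classical
  have : coef α ∘L tmap (.id ℂ (Fock n)) A = A ∘L coef α := clm_ext_tmul_e fun β d => by
    simp only [ContinuousLinearMap.comp_apply, tmap_tmul, ContinuousLinearMap.id_apply, coef_tmul]
    split_ifs <;> simp
  exact DFunLike.congr_fun this u

/-- If the words are sorted by `deg` and `v k` carries the coordinates of `s` at the words with
`deg α = k`, then `∑ₖ v k = s`. -/
theorem hasSum_of_coef_eq (deg : FreeMonoid (Fin n) → ℕ) (v : ℕ → HTensor (Fock n) D)
    (s : HTensor (Fock n) D)
    (h : ∀ α k, coef α (v k) = if deg α = k then coef α s else 0) : HasSum v s := by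
  have h1 := (Equiv.sigmaFiberEquiv deg).hasSum_iff.mpr (hasSum_coef s)
  refine h1.sigma fun k => ?_
  have h2 : HasSum (fun α : {α // deg α = k} => tmul (e α.1) (coef α.1 (v k))) (v k) := by
    refine (hasSum_subtype_iff_of_support_subset (s := {α | deg α = k})
      (f := fun α => tmul (e α) (coef α (v k))) ?_).mpr (hasSum_coef (v k))
    intro α hα
    by_contra hne
    refine hα ?_
    change tmul (e α) (coef α (v k)) = 0
    rw [h, if_neg (show ¬deg α = k from hne), tmul_zero]
  convert h2 using 2 with α
  simp [h, α.2]

end Coef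

/-! ### The creation row and its adjoint -/

section Creation

variable {n : ℕ} {H : Type*} [NormedAddCommGroup H] [InnerProductSpace ℂ H]

theorem word_eq_one_or_mul_of (α : FreeMonoid (Fin n)) :
    α = 1 ∨ ∃ β i, α = β * FreeMonoid.of i := by
  rcases List.eq_nil_or_concat (FreeMonoid.toList α) with h | ⟨β, i, h⟩
  · exact Or.inl h
  · exact Or.inr ⟨FreeMonoid.ofList β, i, h.trans List.concat_eq_append⟩

theorem mul_of_ne_one (α : FreeMonoid (Fin n)) (i : Fin n) : α * FreeMonoid.of i ≠ 1 := by
  intro h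
  have := congrArg FreeMonoid.length h
  simp at this

theorem mul_of_inj {α β : FreeMonoid (Fin n)} {i j : Fin n} :
    α * FreeMonoid.of i = β * FreeMonoid.of j ↔ α = β ∧ i = j := by
  refine ⟨fun h => ?_, fun ⟨h, h'⟩ => h ▸ h' ▸ rfl⟩
  have h' : FreeMonoid.toList α ++ [i] = FreeMonoid.toList β ++ [j] := h
  exact ⟨List.append_inj_left' h' rfl, by simpa using List.append_inj_right' h' rfl⟩

theorem ext_inner_e {x y : Fock n} (h : ∀ γ, inner ℂ x (e γ) = inner ℂ y (e γ)) : x = y := by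
  have : innerSL ℂ x = innerSL ℂ y := clm_ext_e fun γ => by simpa using h γ
  exact ext_inner_right ℂ fun w => by simpa using DFunLike.congr_fun this w

theorem adjoint_R_e_one (i : Fin n) : (R i).adjoint (e 1) = 0 := by
  classical
  refine ext_inner_e fun γ => ?_
  rw [ContinuousLinearMap.adjoint_inner_left, R_e, inner_e, if_neg (mul_of_ne_one γ i).symm,
    inner_zero_left]

theorem adjoint_R_e_mul_of (i j : Fin n) (α : FreeMonoid (Fin n)) :
    (R i).adjoint (e (α * FreeMonoid.of j)) = if i = j then e α else 0 := by
  classical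
  refine ext_inner_e fun γ => ?_
  rw [ContinuousLinearMap.adjoint_inner_left, R_e, inner_e]
  by_cases hij : i = j
  · subst hij
    rw [if_pos rfl, inner_e]
    simp
  · rw [if_neg hij, if_neg fun h => hij (mul_of_inj.mp h).2.symm, inner_zero_left]

/-- The row `[R_1 ⊗ I, …, R_n ⊗ I] : F²(H_n) ⊗ H^(n) → F²(H_n) ⊗ H`. -/
def rowR (n : ℕ) (H : Type*) [NormedAddCommGroup H] [InnerProductSpace ℂ H] :
    HTensor (Fock n) (Copies n H) →L[ℂ] HTensor (Fock n) H :=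
  ∑ i, tmap (R i) (coord i)

/-- `∑ R_i ⊗ T_i^*` on `F²(H_n) ⊗ H`. -/
def sumRT [CompleteSpace H] (T : Fin n → H →L[ℂ] H) :
    HTensor (Fock n) H →L[ℂ] HTensor (Fock n) H :=
  ∑ i, tmap (R i) (T i).adjoint

variable [CompleteSpace H]

theorem adjoint_coord (i : Fin n) (h : H) :
    (coord i : Copies n H →L[ℂ] H).adjoint h = WithLp.toLp 2 (Pi.single i h) := by
  classical
  refine ext_inner_left ℂ fun v => ?_
  rw [ContinuousLinearMap.adjoint_inner_right, PiLp.inner_apply, Finset.sum_eq_single i]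
  · simp [coord]
  · intro j _ hj
    simp [hj]
  · simp

theorem coord_adjoint_coord (i j : Fin n) (h : H) :
    (coord j : Copies n H →L[ℂ] H) ((coord i : Copies n H →L[ℂ] H).adjoint h) =
      if j = i then h else 0 := by
  rw [adjoint_coord]
  simp [coord]

theorem row_comp_adjoint_coord (T : Fin n → H →L[ℂ] H) (i : Fin n) (h : H) :
    row T ((coord i : Copies n H →L[ℂ] H).adjoint h) = T i h := by
  simp [row, coord_adjoint_coord, apply_ite]

theorem adjoint_rowR : (rowR n H).adjoint = ∑ i, tmap (R i).adjoint (coord i).adjoint := by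
  simp only [rowR, map_sum, adjoint_tmap]

theorem adjoint_rowR_tmul_one (h : H) : (rowR n H).adjoint (tmul (e 1) h) = 0 := by
  simp [adjoint_rowR, tmap_tmul, adjoint_R_e_one]

theorem adjoint_rowR_tmul_mul_of (α : FreeMonoid (Fin n)) (i : Fin n) (h : H) :
    (rowR n H).adjoint (tmul (e (α * FreeMonoid.of i)) h) =
      tmul (e α) ((coord i : Copies n H →L[ℂ] H).adjoint h) := by
  rw [adjoint_rowR, sum_apply, Finset.sum_eq_single i]
  · rw [tmap_tmul, adjoint_R_e_mul_of, if_pos rfl]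
  · intro j _ hj
    rw [tmap_tmul, adjoint_R_e_mul_of, if_neg hj, zero_tmul]
  · simp

theorem adjoint_sumRT (T : Fin n → H →L[ℂ] H) :
    (sumRT T).adjoint = tmap (.id ℂ _) (row T) ∘L (rowR n H).adjoint := by
  refine clm_ext_tmul fun x h => ?_
  simp [sumRT, adjoint_rowR, adjoint_tmap, tmap_tmul,
    row_comp_adjoint_coord]

theorem adjoint_sumRT_tmul_one (T : Fin n → H →L[ℂ] H) (h : H) :
    (sumRT T).adjoint (tmul (e 1) h) = 0 := by
  rw [adjoint_sumRT, ContinuousLinearMap.comp_apply, adjoint_rowR_tmul_one, map_zero]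

theorem adjoint_sumRT_tmul_mul_of (T : Fin n → H →L[ℂ] H) (α : FreeMonoid (Fin n)) (i : Fin n)
    (h : H) :
    (sumRT T).adjoint (tmul (e (α * FreeMonoid.of i)) h) = tmul (e α) (T i h) := by
  rw [adjoint_sumRT, ContinuousLinearMap.comp_apply, adjoint_rowR_tmul_mul_of, tmap_tmul,
    row_comp_adjoint_coord, ContinuousLinearMap.id_apply]

theorem rowR_comp_adjoint (u : HTensor (Fock n) H) :
    rowR n H ((rowR n H).adjoint u) + tmul (e 1) (coef 1 u) = u := by
  classical
  suffices h : rowR n H ∘L (rowR n H).adjoint + tmulLeft H (e 1) ∘L coef 1 = .id ℂ _ from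
    DFunLike.congr_fun h u
  refine clm_ext_tmul_e fun α h => ?_
  simp only [add_apply, ContinuousLinearMap.comp_apply, tmulLeft_apply,
    ContinuousLinearMap.id_apply, coef_tmul]
  rcases word_eq_one_or_mul_of α with rfl | ⟨β, i, rfl⟩
  · simp [adjoint_rowR_tmul_one]
  · rw [adjoint_rowR_tmul_mul_of, if_neg (mul_of_ne_one β i).symm, tmul_zero, add_zero, rowR,
      sum_apply, Finset.sum_eq_single i]
    · rw [tmap_tmul, R_e, coord_adjoint_coord, if_pos rfl]
    · intro j _ hj
      rw [tmap_tmul, coord_adjoint_coord, if_neg hj, tmul_zero]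
    · simp

theorem norm_adjoint_rowR_sq (u : HTensor (Fock n) H) :
    ‖(rowR n H).adjoint u‖ ^ 2 + ‖coef 1 u‖ ^ 2 = ‖u‖ ^ 2 := by
  have h := congrArg (fun w => inner ℂ w u) (rowR_comp_adjoint u)
  simp only [inner_add_left] at h
  rw [← ContinuousLinearMap.adjoint_inner_right, ← inner_coef_right, inner_self_eq_norm_sq_to_K,
    inner_self_eq_norm_sq_to_K, inner_self_eq_norm_sq_to_K] at h
  exact_mod_cast h

theorem adjoint_sumRT_pow_tmul_e (T : Fin n → H →L[ℂ] H) (α : FreeMonoid (Fin n)) (k : ℕ)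
    (hk : α.length < k) (h : H) : ((sumRT T).adjoint ^ k) (tmul (e α) h) = 0 := by
  induction k generalizing α h with
  | zero => simp at hk
  | succ k ih =>
    rw [pow_succ, mul_apply_eq_comp]
    rcases word_eq_one_or_mul_of α with rfl | ⟨β, i, rfl⟩
    · rw [adjoint_sumRT_tmul_one, map_zero]
    · rw [adjoint_sumRT_tmul_mul_of]
      exact ih _ (by simp at hk; omega) _

theorem coef_one_rowR (u : HTensor (Fock n) (Copies n H)) : coef 1 (rowR n H u) = 0 := by
  refine ext_inner_left ℂ fun h => ?_
  rw [inner_coef_right, ← ContinuousLinearMap.adjoint_inner_left, adjoint_rowR_tmul_one]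
  simp

theorem coef_mul_of_rowR (α : FreeMonoid (Fin n)) (i : Fin n)
    (u : HTensor (Fock n) (Copies n H)) :
    coef (α * FreeMonoid.of i) (rowR n H u) = coord i (coef α u) := by
  refine ext_inner_left ℂ fun h => ?_
  rw [inner_coef_right, ← ContinuousLinearMap.adjoint_inner_left, adjoint_rowR_tmul_mul_of,
    ← inner_coef_right, ContinuousLinearMap.adjoint_inner_left]

theorem sumRT_eq (T : Fin n → H →L[ℂ] H) :
    sumRT T = rowR n H ∘L tmap (.id ℂ _) (row T).adjoint := by
  have h := congrArg ContinuousLinearMap.adjoint (adjoint_sumRT T)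
  rwa [ContinuousLinearMap.adjoint_adjoint, ContinuousLinearMap.adjoint_comp,
    ContinuousLinearMap.adjoint_adjoint, adjoint_tmap, ContinuousLinearMap.adjoint_id] at h

end Creation

/-! ### Homogeneous vectors -/

section Homogeneous

variable {n : ℕ} {H D D' : Type*} [NormedAddCommGroup H] [InnerProductSpace ℂ H] [CompleteSpace H]
  [NormedAddCommGroup D] [InnerProductSpace ℂ D] [CompleteSpace D]
  [NormedAddCommGroup D'] [InnerProductSpace ℂ D'] [CompleteSpace D']

/-- `u ∈ F²(H_n) ⊗ D` is homogeneous of degree `m`: only the words of length `m` occur in it. -/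
def IsHomogeneous (m : ℕ) (u : HTensor (Fock n) D) : Prop :=
  ∀ α : FreeMonoid (Fin n), α.length ≠ m → coef α u = 0

theorem isHomogeneous_tmul_e (α : FreeMonoid (Fin n)) (d : D) :
    IsHomogeneous α.length (tmul (e α) d) := by
  classical
  intro β hβ
  rw [coef_tmul, if_neg fun h : β = α => hβ (h ▸ rfl)]

theorem IsHomogeneous.tmap_id {m : ℕ} {u : HTensor (Fock n) D} (hu : IsHomogeneous m u)
    (A : D →L[ℂ] D') : IsHomogeneous m (tmap (.id ℂ (Fock n)) A u) := fun α hα => by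
  rw [coef_tmap_id, hu α hα, map_zero]

theorem IsHomogeneous.rowR {m : ℕ} {u : HTensor (Fock n) (Copies n H)}
    (hu : IsHomogeneous m u) : IsHomogeneous (m + 1) (rowR n H u) := fun α hα => by
  rcases word_eq_one_or_mul_of α with rfl | ⟨β, i, rfl⟩
  · exact coef_one_rowR u
  · rw [coef_mul_of_rowR, hu β (by simpa using hα), map_zero]

theorem IsHomogeneous.sumRT_pow {m : ℕ} {u : HTensor (Fock n) H} (hu : IsHomogeneous m u)
    (T : Fin n → H →L[ℂ] H) (k : ℕ) : IsHomogeneous (m + k) ((sumRT T ^ k) u) := by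
  induction k with
  | zero => simpa using hu
  | succ k ih =>
    rw [pow_succ', mul_apply_eq_comp, sumRT_eq]
    rw [sumRT_eq] at ih
    exact (ih.tmap_id _).rowR

end Homogeneous

/-! ### The transfer function of an isometric colligation -/

section Colligation

variable {n : ℕ} {H X Y : Type*} [NormedAddCommGroup H] [InnerProductSpace ℂ H]
  [NormedAddCommGroup X] [InnerProductSpace ℂ X] [NormedAddCommGroup Y] [InnerProductSpace ℂ Y]

theorem wordOp_mul_of (T : Fin n → H →L[ℂ] H) (α : FreeMonoid (Fin n)) (i : Fin n) :
    wordOp T (α * FreeMonoid.of i) = wordOp T α ∘L T i := by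
  rw [wordOp, map_mul, FreeMonoid.lift_eval_of]; rfl

/-- The finitely supported families of vectors, as polynomials `∑ e_α ⊗ d_α`. -/
def polyMap (n : ℕ) (X : Type*) [NormedAddCommGroup X] [InnerProductSpace ℂ X] :
    (FreeMonoid (Fin n) →₀ X) →ₗ[ℂ] HTensor (Fock n) X :=
  Finsupp.lsum ℂ fun α => (tmulLeft X (e α)).toLinearMap

@[simp] theorem polyMap_single (α : FreeMonoid (Fin n)) (x : X) :
    polyMap n X (Finsupp.single α x) = tmul (e α) x := by
  simp [polyMap]

variable [CompleteSpace H] [CompleteSpace X] [CompleteSpace Y]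

/-- The block operator `[[T, C^*], [C', -E]] : H^(n) ⊕ X → H ⊕ Y` is an isometry. -/
structure IsIsometricColligation (T : Fin n → H →L[ℂ] H) (C : H →L[ℂ] X)
    (C' : Copies n H →L[ℂ] Y) (E : X →L[ℂ] Y) : Prop where
  state : (row T).adjoint ∘L row T + C'.adjoint ∘L C' = .id ℂ _
  input : C ∘L C.adjoint + E.adjoint ∘L E = .id ℂ _
  cross : (row T).adjoint ∘L C.adjoint = C'.adjoint ∘L E

/-- The part of degree `k + 1` of `(I ⊗ C) (I - ∑ R_i ⊗ T_i^*)⁻¹ [R_1 ⊗ I, …, R_n ⊗ I] (I ⊗ C'^*)`. -/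
def transferPart (T : Fin n → H →L[ℂ] H) (C : H →L[ℂ] X) (C' : Copies n H →L[ℂ] Y) (k : ℕ) :
    HTensor (Fock n) Y →L[ℂ] HTensor (Fock n) X :=
  tmap (.id ℂ _) C ∘L (sumRT T ^ k) ∘L rowR n H ∘L tmap (.id ℂ _) C'.adjoint

theorem adjoint_pow (A : H →L[ℂ] H) (k : ℕ) : (A ^ k).adjoint = A.adjoint ^ k := by
  rw [← ContinuousLinearMap.star_eq_adjoint, ← ContinuousLinearMap.star_eq_adjoint, star_pow]

theorem adjoint_transferPart (T : Fin n → H →L[ℂ] H) (C : H →L[ℂ] X)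
    (C' : Copies n H →L[ℂ] Y) (k : ℕ) :
    (transferPart T C C' k).adjoint = tmap (.id ℂ _) C' ∘L (rowR n H).adjoint ∘L
      ((sumRT T).adjoint ^ k) ∘L tmap (.id ℂ _) C.adjoint := by
  simp only [transferPart, ContinuousLinearMap.adjoint_comp, adjoint_tmap, adjoint_pow,
    ContinuousLinearMap.adjoint_adjoint, ContinuousLinearMap.adjoint_id,
    ContinuousLinearMap.comp_assoc]

theorem isHomogeneous_transferPart (T : Fin n → H →L[ℂ] H) (C : H →L[ℂ] X)
    (C' : Copies n H →L[ℂ] Y) (k : ℕ) (γ : FreeMonoid (Fin n)) (d : Y) :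
    IsHomogeneous (γ.length + 1 + k) (transferPart T C C' k (tmul (e γ) d)) :=
  ((((isHomogeneous_tmul_e γ d).tmap_id _).rowR).sumRT_pow T k).tmap_id C

theorem denseRange_polyMap : DenseRange (polyMap n X) := by
  intro u
  refine mem_closure_of_tendsto (hasSum_coef u) (Eventually.of_forall fun s => ?_)
  exact ⟨∑ α ∈ s, Finsupp.single α (coef α u), by simp⟩

/-- `(I - ∑ R_i^* ⊗ T_i)⁻¹ (I ⊗ C^*)` on polynomials, where the Neumann series is finite. -/
def resolventMap (T : Fin n → H →L[ℂ] H) (C : H →L[ℂ] X) :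
    (FreeMonoid (Fin n) →₀ X) →ₗ[ℂ] HTensor (Fock n) H :=
  Finsupp.lsum ℂ fun α => ((∑ k ∈ Finset.range (α.length + 1), (sumRT T).adjoint ^ k) ∘L
    tmulLeft H (e α) ∘L C.adjoint).toLinearMap

theorem resolventMap_single (T : Fin n → H →L[ℂ] H) (C : H →L[ℂ] X) (α : FreeMonoid (Fin n))
    (x : X) : resolventMap T C (Finsupp.single α x) =
      ∑ k ∈ Finset.range (α.length + 1), ((sumRT T).adjoint ^ k) (tmul (e α) (C.adjoint x)) := by
  rw [resolventMap, Finsupp.lsum_single]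
  simp only [ContinuousLinearMap.coe_coe, ContinuousLinearMap.comp_apply, sum_apply, tmulLeft_apply]

theorem resolventMap_eq (T : Fin n → H →L[ℂ] H) (C : H →L[ℂ] X) (p : FreeMonoid (Fin n) →₀ X) :
    resolventMap T C p = (sumRT T).adjoint (resolventMap T C p) +
      tmap (.id ℂ _) C.adjoint (polyMap n X p) := by
  suffices h : resolventMap T C = (sumRT T).adjoint.toLinearMap ∘ₗ resolventMap T C +
      (tmap (.id ℂ _) C.adjoint).toLinearMap ∘ₗ polyMap n X from DFunLike.congr_fun h p
  refine Finsupp.lhom_ext fun α x => ?_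
  simp only [LinearMap.add_apply, LinearMap.comp_apply, ContinuousLinearMap.coe_coe,
    resolventMap_single, polyMap_single, tmap_tmul, ContinuousLinearMap.id_apply, map_sum]
  rw [Finset.sum_range_succ', pow_zero]
  congr 1
  conv_rhs => rw [Finset.sum_range_succ]
  simp only [← ContinuousLinearMap.comp_apply, ← ContinuousLinearMap.mul_def, ← pow_succ']
  rw [adjoint_sumRT_pow_tmul_e T α _ (Nat.lt_succ_self _), add_zero]

theorem inner_tmap_id {D D' D'' : Type*} [NormedAddCommGroup D] [InnerProductSpace ℂ D]
    [CompleteSpace D] [NormedAddCommGroup D'] [InnerProductSpace ℂ D'] [CompleteSpace D']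
    [NormedAddCommGroup D''] [InnerProductSpace ℂ D'']
    (A : D →L[ℂ] D') (A' : D'' →L[ℂ] D') (u : HTensor (Fock n) D) (v : HTensor (Fock n) D'') :
    inner ℂ (tmap (.id ℂ (Fock n)) A u) (tmap (.id ℂ _) A' v) =
      inner ℂ u (tmap (.id ℂ _) (A.adjoint ∘L A') v) := by
  rw [← ContinuousLinearMap.adjoint_inner_right, adjoint_tmap, ContinuousLinearMap.adjoint_id,
    ← ContinuousLinearMap.comp_apply, tmap_comp, ContinuousLinearMap.comp_id]

/-- The colligation identity summed over all words, `‖y‖² + ‖Θ^* x‖² = ‖Z^* y‖² + ‖x‖²`, for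
`Z = [R_1 ⊗ I, …, R_n ⊗ I]`, `y = (I - T Z^*)⁻¹ C^* x` and `Θ^* x = C' Z^* y - E x`, with
`‖y‖² - ‖Z^* y‖²` expressed by the vacuum coordinate of `y`. -/
theorem IsIsometricColligation.norm_sq {T : Fin n → H →L[ℂ] H} {C : H →L[ℂ] X}
    {C' : Copies n H →L[ℂ] Y} {E : X →L[ℂ] Y} (h : IsIsometricColligation T C C' E)
    (p : FreeMonoid (Fin n) →₀ X) :
    ‖tmap (.id ℂ (Fock n)) C' ((rowR n H).adjoint (resolventMap T C p)) -
        tmap (.id ℂ _) E (polyMap n X p)‖ ^ 2 + ‖coef 1 (resolventMap T C p)‖ ^ 2 =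
      ‖polyMap n X p‖ ^ 2 := by
  set y := resolventMap T C p
  set x := polyMap n X p
  set z := (rowR n H).adjoint y
  have hy' : y = tmap (.id ℂ _) (row T) z + tmap (.id ℂ _) C.adjoint x := by
    have := resolventMap_eq T C p
    rwa [adjoint_sumRT] at this
  have hbal := norm_adjoint_rowR_sq y
  have hout : inner ℂ (tmap (.id ℂ (Fock n)) (row T) z) (tmap (.id ℂ (Fock n)) (row T) z) +
      inner ℂ (tmap (.id ℂ (Fock n)) C' z) (tmap (.id ℂ (Fock n)) C' z) = inner ℂ z z := by
    rw [inner_tmap_id, inner_tmap_id, ← inner_add_right, ← add_apply, ← tmap_add_right, h.state,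
      tmap_id, ContinuousLinearMap.id_apply]
  have hin : inner ℂ (tmap (.id ℂ (Fock n)) C.adjoint x) (tmap (.id ℂ (Fock n)) C.adjoint x) +
      inner ℂ (tmap (.id ℂ (Fock n)) E x) (tmap (.id ℂ (Fock n)) E x) = inner ℂ x x := by
    rw [inner_tmap_id, inner_tmap_id, ← inner_add_right, ← add_apply, ← tmap_add_right,
      ContinuousLinearMap.adjoint_adjoint, h.input, tmap_id, ContinuousLinearMap.id_apply]
  have hcross : inner ℂ (tmap (.id ℂ (Fock n)) (row T) z) (tmap (.id ℂ (Fock n)) C.adjoint x) =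
      inner ℂ (tmap (.id ℂ (Fock n)) C' z) (tmap (.id ℂ (Fock n)) E x) := by
    rw [inner_tmap_id, inner_tmap_id, h.cross]
  simp only [inner_self_eq_norm_sq_to_K] at hout hin
  norm_cast at hout hin
  have hy2 := norm_add_sq (𝕜 := ℂ) (tmap (.id ℂ (Fock n)) (row T) z)
    (tmap (.id ℂ (Fock n)) C.adjoint x)
  rw [← hy', hcross] at hy2
  rw [norm_sub_sq (𝕜 := ℂ)]
  linarith

/-- The transfer function `Θ = -E^* + C (I - Z T^*)⁻¹ Z C'^*` of an isometric colligation, where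
`Z = [R_1 ⊗ I, …, R_n ⊗ I]`, exists as a bounded operator, and its defect `I - Θ Θ^*` is `K K^*` for the
Poisson kernel `K h = ∑ e_α ⊗ C T_α^* h`. Both are obtained as adjoints of extensions of operators
that are defined on polynomials by finite sums. -/
theorem exists_transferFunction {T : Fin n → H →L[ℂ] H} {C : H →L[ℂ] X}
    {C' : Copies n H →L[ℂ] Y} {E : X →L[ℂ] Y} (h : IsIsometricColligation T C C' E) :
    ∃ (Θ : HTensor (Fock n) Y →L[ℂ] HTensor (Fock n) X) (K : H →L[ℂ] HTensor (Fock n) X),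
      .id ℂ _ - Θ ∘L Θ.adjoint = K ∘L K.adjoint ∧
      (∀ h, HasSum (fun α => tmul (e α) (C ((wordOp T α).adjoint h))) (K h)) ∧
      ∀ γ d, HasSum (fun k => transferPart T C C' k (tmul (e γ) d))
        (Θ (tmul (e γ) d) + tmap (.id ℂ _) E.adjoint (tmul (e γ) d)) := by
  let θ : (FreeMonoid (Fin n) →₀ X) →ₗ[ℂ] HTensor (Fock n) Y :=
    (tmap (.id ℂ (Fock n)) C' ∘L (rowR n H).adjoint).toLinearMap ∘ₗ resolventMap T C -
      (tmap (.id ℂ _) E).toLinearMap ∘ₗ polyMap n X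
  let κ : (FreeMonoid (Fin n) →₀ X) →ₗ[ℂ] H := (coef 1).toLinearMap ∘ₗ resolventMap T C
  have hnorm : ∀ p, ‖θ p‖ ^ 2 + ‖κ p‖ ^ 2 = ‖polyMap n X p‖ ^ 2 := h.norm_sq
  have hθ : ∀ p, ‖θ p‖ ≤ 1 * ‖polyMap n X p‖ := fun p => by
    rw [one_mul]
    exact le_of_sq_le_sq (by nlinarith [hnorm p, sq_nonneg ‖κ p‖]) (norm_nonneg _)
  have hκ : ∀ p, ‖κ p‖ ≤ 1 * ‖polyMap n X p‖ := fun p => by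
    rw [one_mul]
    exact le_of_sq_le_sq (by nlinarith [hnorm p, sq_nonneg ‖θ p‖]) (norm_nonneg _)
  let L := θ.extendOfNorm (polyMap n X)
  let M := κ.extendOfNorm (polyMap n X)
  have hL : ∀ p, L (polyMap n X p) = θ p :=
    LinearMap.extendOfNorm_eq denseRange_polyMap ⟨1, hθ⟩
  have hM : ∀ p, M (polyMap n X p) = κ p :=
    LinearMap.extendOfNorm_eq denseRange_polyMap ⟨1, hκ⟩
  have hLM : ∀ u, ‖L u‖ ^ 2 + ‖M u‖ ^ 2 = ‖u‖ ^ 2 := by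
    have : (fun u => ‖L u‖ ^ 2 + ‖M u‖ ^ 2) = fun u => ‖u‖ ^ 2 :=
      denseRange_polyMap.equalizer (by fun_prop) (by fun_prop)
        (funext fun p => by simp only [Function.comp, hL, hM, hnorm])
    exact congrFun this
  -- peeling the last letter off `α` shows that the vacuum coordinate of the resolvent is `T_α`
  have hMe : ∀ α x, M (tmul (e α) x) = wordOp T α (C.adjoint x) := by
    intro α x
    have hκe : ∀ m (α : FreeMonoid (Fin n)) (v : H), α.length = m →
        coef 1 (∑ k ∈ Finset.range (m + 1), ((sumRT T).adjoint ^ k) (tmul (e α) v)) =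
          wordOp T α v := by
      classical
      intro m
      induction m with
      | zero =>
        intro α v hα
        obtain rfl := FreeMonoid.length_eq_zero.mp hα
        simp [coef_tmul, wordOp]
      | succ m ih =>
        intro α v hα
        rcases word_eq_one_or_mul_of α with rfl | ⟨β, i, rfl⟩
        · simp at hα
        · rw [Finset.sum_range_succ', pow_zero, map_add]
          simp only [pow_succ, mul_apply_eq_comp, adjoint_sumRT_tmul_mul_of]
          rw [ih β (T i v) (by simpa using hα), one_apply_eq_self, coef_tmul,
            if_neg (mul_of_ne_one β i).symm, add_zero, wordOp_mul_of]
          rfl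
    rw [← polyMap_single, hM]
    change coef 1 (resolventMap T C _) = _
    rw [resolventMap_single, hκe _ α _ rfl]
  have hLe : ∀ α x, L (tmul (e α) x) =
      (∑ k ∈ Finset.range (α.length + 1), (transferPart T C C' k).adjoint (tmul (e α) x)) -
        tmap (.id ℂ _) E (tmul (e α) x) := by
    intro α x
    rw [← polyMap_single, hL]
    change tmap (.id ℂ (Fock n)) C' ((rowR n H).adjoint (resolventMap T C _)) -
      tmap (.id ℂ _) E (polyMap n X _) = _
    simp only [resolventMap_single, polyMap_single, adjoint_transferPart, map_sum,
      ContinuousLinearMap.comp_apply, tmap_tmul, ContinuousLinearMap.id_apply]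
  refine ⟨L.adjoint, M.adjoint, ?_, fun v => ?_, fun γ d => ?_⟩
  · rw [sub_eq_iff_eq_add, ContinuousLinearMap.adjoint_adjoint, ContinuousLinearMap.adjoint_adjoint]
    refine ContinuousLinearMap.coe_injective ((ext_inner_map _ _).mp fun u => ?_)
    simp only [ContinuousLinearMap.coe_coe, add_apply, ContinuousLinearMap.comp_apply,
      ContinuousLinearMap.id_apply, inner_add_left, ContinuousLinearMap.adjoint_inner_left,
      inner_self_eq_norm_sq_to_K]
    have := hLM u
    rw [add_comm] at this
    exact_mod_cast this.symm
  · have hc : ∀ α, coef α (M.adjoint v) = C ((wordOp T α).adjoint v) := fun α => by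
      refine ext_inner_left ℂ fun x => ?_
      rw [inner_coef_right, ContinuousLinearMap.adjoint_inner_right, hMe,
        ← ContinuousLinearMap.adjoint_inner_right, ContinuousLinearMap.adjoint_inner_left]
    simpa only [hc] using hasSum_coef (M.adjoint v)
  · set u := tmul (e γ : Fock n) d
    have hs : ∀ α, coef α (L.adjoint u + tmap (.id ℂ _) E.adjoint u) =
        ∑ k ∈ Finset.range (α.length + 1), coef α (transferPart T C C' k u) := by
      intro α
      refine ext_inner_left ℂ fun x => ?_
      rw [map_add, inner_add_right, inner_coef_right, inner_coef_right, inner_sum,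
        ContinuousLinearMap.adjoint_inner_right, hLe, inner_sub_left, sum_inner]
      have : inner ℂ (tmul (e α) x) (tmap (.id ℂ (Fock n)) E.adjoint u) =
          inner ℂ (tmap (.id ℂ (Fock n)) E (tmul (e α) x)) u := by
        rw [← ContinuousLinearMap.adjoint_inner_right, adjoint_tmap,
          ContinuousLinearMap.adjoint_id]
      rw [this, sub_add_cancel]
      exact Finset.sum_congr rfl fun k _ => by
        rw [ContinuousLinearMap.adjoint_inner_left, inner_coef_right]
    have hv : ∀ k α, α.length ≠ γ.length + 1 + k → coef α (transferPart T C C' k u) = 0 :=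
      fun k => isHomogeneous_transferPart T C C' k γ d
    refine hasSum_of_coef_eq (fun α => α.length - (γ.length + 1)) _ _ fun α k => ?_
    -- words no longer than `γ` carry no coordinate, so truncated subtraction is harmless
    by_cases hα : α.length = γ.length + 1 + k
    · rw [if_pos (by omega), hs, Finset.sum_eq_single k]
      · intro j _ hj
        exact hv j α (by omega)
      · intro hk
        simp only [Finset.mem_range] at hk
        omega
    · rw [hv k α hα]
      split_ifs with hk
      · rw [hs, Finset.sum_eq_zero fun j _ => hv j α (by omega)]
      · rfl

end Colligation

/-! ### Defect operators and the Halmos colligation -/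

section Intertwining

variable {H K : Type*} [NormedAddCommGroup H] [InnerProductSpace ℂ H]
  [NormedAddCommGroup K] [InnerProductSpace ℂ K]

theorem comp_aeval_of_intertwine {a : H →L[ℂ] H} {b : K →L[ℂ] K} {V : H →L[ℂ] K}
    (h : V ∘L a = b ∘L V) (p : Polynomial ℝ) :
    V ∘L Polynomial.aeval a p = Polynomial.aeval b p ∘L V := by
  induction p using Polynomial.induction_on with
  | C r => ext x; simp [Algebra.algebraMap_eq_smul_one]
  | add p q hp hq => simp [hp, hq, ContinuousLinearMap.comp_add, ContinuousLinearMap.add_comp]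
  | monomial m r ih =>
    simp only [pow_succ, ← mul_assoc, map_mul, Polynomial.aeval_X] at ih ⊢
    simp only [ContinuousLinearMap.mul_def] at ih ⊢
    rw [← ContinuousLinearMap.comp_assoc, ih, ContinuousLinearMap.comp_assoc, h,
      ContinuousLinearMap.comp_assoc]
    simp only [ContinuousLinearMap.comp_assoc]

variable [CompleteSpace H] [CompleteSpace K]

/-- An operator that intertwines two self-adjoint operators intertwines their continuous functions:
by Weierstrass this reduces to polynomials. -/
theorem comp_cfc_of_intertwine {a : H →L[ℂ] H} {b : K →L[ℂ] K} (ha : IsSelfAdjoint a)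
    (hb : IsSelfAdjoint b) {V : H →L[ℂ] K} (h : V ∘L a = b ∘L V) {f : ℝ → ℝ} (hf : Continuous f) :
    V ∘L cfc f a = cfc f b ∘L V := by
  set M := max (‖a‖ * ‖(1 : H →L[ℂ] H)‖) (‖b‖ * ‖(1 : K →L[ℂ] K)‖)
  rw [← sub_eq_zero, ← norm_le_zero_iff]
  refine le_of_forall_pos_le_add fun ε hε => ?_
  set δ := ε / (2 * (‖V‖ + 1)) with hδ
  have hδ0 : 0 < δ := by positivity
  obtain ⟨p, hp⟩ := exists_polynomial_near_of_continuousOn (-M) M f hf.continuousOn δ hδ0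
  have hpa : ‖cfc f a - Polynomial.aeval a p‖ ≤ δ := by
    rw [← cfc_polynomial (R := ℝ) p a, ← cfc_sub f p.eval a]
    refine norm_cfc_le hδ0.le fun x hx => ?_
    have hx' : |x| ≤ M := (spectrum.norm_le_norm_mul_of_mem hx).trans (le_max_left _ _)
    rw [Real.norm_eq_abs, abs_sub_comm]
    exact (hp x (abs_le.mp hx')).le
  have hpb : ‖cfc f b - Polynomial.aeval b p‖ ≤ δ := by
    rw [← cfc_polynomial (R := ℝ) p b, ← cfc_sub f p.eval b]
    refine norm_cfc_le hδ0.le fun x hx => ?_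
    have hx' : |x| ≤ M := (spectrum.norm_le_norm_mul_of_mem hx).trans (le_max_right _ _)
    rw [Real.norm_eq_abs, abs_sub_comm]
    exact (hp x (abs_le.mp hx')).le
  have hdec : V ∘L cfc f a - cfc f b ∘L V =
      V ∘L (cfc f a - Polynomial.aeval a p) - (cfc f b - Polynomial.aeval b p) ∘L V := by
    rw [ContinuousLinearMap.comp_sub, ContinuousLinearMap.sub_comp, comp_aeval_of_intertwine h]
    abel
  calc ‖V ∘L cfc f a - cfc f b ∘L V‖
      ≤ ‖V‖ * δ + δ * ‖V‖ := by
        rw [hdec]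
        refine (norm_sub_le _ _).trans (add_le_add ?_ ?_)
        · exact (ContinuousLinearMap.opNorm_comp_le _ _).trans (by gcongr)
        · exact (ContinuousLinearMap.opNorm_comp_le _ _).trans (by gcongr)
    _ ≤ 0 + ε := by
        have : δ * (2 * (‖V‖ + 1)) = ε := by rw [hδ]; field_simp
        nlinarith [norm_nonneg V]

theorem adjoint_comp_sqrt (V : K →L[ℂ] H) (h : 0 ≤ 1 - V ∘L V.adjoint)
    (h' : 0 ≤ 1 - V.adjoint ∘L V) :
    V.adjoint ∘L CFC.sqrt (1 - V ∘L V.adjoint) = CFC.sqrt (1 - V.adjoint ∘L V) ∘L V.adjoint := by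
  rw [CFC.sqrt_eq_real_sqrt _ h, CFC.sqrt_eq_real_sqrt _ h', cfcₙ_eq_cfc, cfcₙ_eq_cfc]
  refine comp_cfc_of_intertwine (IsSelfAdjoint.of_nonneg h) (IsSelfAdjoint.of_nonneg h') ?_
    Real.continuous_sqrt
  ext1 x
  simp

theorem adjoint_sqrt (a : H →L[ℂ] H) : (CFC.sqrt a).adjoint = CFC.sqrt a :=
  (IsSelfAdjoint.of_nonneg (CFC.sqrt_nonneg a)).adjoint_eq

theorem sqrt_comp_sqrt {a : H →L[ℂ] H} (ha : 0 ≤ a) : CFC.sqrt a ∘L CFC.sqrt a = a :=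
  CFC.sqrt_mul_sqrt_self a ha

end Intertwining

section Defect

variable {n : ℕ} {H : Type*} [NormedAddCommGroup H] [InnerProductSpace ℂ H] [CompleteSpace H]
  {T : Fin n → H →L[ℂ] H}

theorem row_comp_adjoint_row (T : Fin n → H →L[ℂ] H) :
    row T ∘L (row T).adjoint = ∑ i, T i ∘L (T i).adjoint := by
  have h : (row T).adjoint = ∑ i, (coord i).adjoint ∘L (T i).adjoint := by
    simp only [row, map_sum, ContinuousLinearMap.adjoint_comp]
  ext x
  simp [h, row_comp_adjoint_coord]

theorem IsRowContraction.one_sub_nonneg (hT : IsRowContraction T) :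
    0 ≤ 1 - row T ∘L (row T).adjoint := by
  rw [row_comp_adjoint_row]
  exact sub_nonneg.mpr hT

theorem IsRowContraction.norm_row_le (hT : IsRowContraction T) : ‖row T‖ ≤ 1 := by
  rw [← ContinuousLinearMap.adjoint.norm_map (row T)]
  refine ContinuousLinearMap.opNorm_le_bound _ zero_le_one fun x => ?_
  have h := ((ContinuousLinearMap.nonneg_iff_isPositive _).mp
    hT.one_sub_nonneg).re_inner_nonneg_left x
  rw [sub_apply, inner_sub_left, ContinuousLinearMap.comp_apply,
    ← ContinuousLinearMap.adjoint_inner_right (row T), one_apply_eq_self, map_sub,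
    inner_self_eq_norm_sq, inner_self_eq_norm_sq] at h
  rw [one_mul]
  exact le_of_sq_le_sq (by linarith) (norm_nonneg _)

theorem IsRowContraction.one_sub_star_nonneg (hT : IsRowContraction T) :
    0 ≤ 1 - (row T).adjoint ∘L row T := by
  rw [ContinuousLinearMap.nonneg_iff_isPositive, ContinuousLinearMap.isPositive_def']
  refine ⟨?_, fun x => ?_⟩
  · refine IsSelfAdjoint.sub (IsSelfAdjoint.one _) ?_
    rw [ContinuousLinearMap.isSelfAdjoint_iff']
    rw [ContinuousLinearMap.adjoint_comp, ContinuousLinearMap.adjoint_adjoint]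
  · rw [ContinuousLinearMap.reApplyInnerSelf_apply, sub_apply, inner_sub_left,
      ContinuousLinearMap.comp_apply, ContinuousLinearMap.adjoint_inner_left, one_apply_eq_self,
      map_sub, inner_self_eq_norm_sq, inner_self_eq_norm_sq]
    have h : ‖row T x‖ ≤ ‖x‖ := by
      simpa using (row T).le_of_opNorm_le hT.norm_row_le x
    nlinarith [norm_nonneg (row T x), norm_nonneg x]

theorem IsRowContraction.defect_comp_self (hT : IsRowContraction T) :
    defect T ∘L defect T = 1 - row T ∘L (row T).adjoint := by
  rw [defect, ← row_comp_adjoint_row]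
  exact sqrt_comp_sqrt hT.one_sub_nonneg

theorem IsRowContraction.defectStar_comp_self (hT : IsRowContraction T) :
    defectStar T ∘L defectStar T = 1 - (row T).adjoint ∘L row T :=
  sqrt_comp_sqrt hT.one_sub_star_nonneg

theorem adjoint_defect (T : Fin n → H →L[ℂ] H) : (defect T).adjoint = defect T :=
  adjoint_sqrt _

theorem adjoint_defectStar (T : Fin n → H →L[ℂ] H) : (defectStar T).adjoint = defectStar T :=
  adjoint_sqrt _

theorem IsRowContraction.adjoint_row_comp_defect (hT : IsRowContraction T) :
    (row T).adjoint ∘L defect T = defectStar T ∘L (row T).adjoint := by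
  rw [defect, defectStar, ← row_comp_adjoint_row]
  exact adjoint_comp_sqrt _ hT.one_sub_nonneg hT.one_sub_star_nonneg

theorem IsRowContraction.row_comp_defectStar (hT : IsRowContraction T) :
    row T ∘L defectStar T = defect T ∘L row T := by
  have h := congrArg ContinuousLinearMap.adjoint hT.adjoint_row_comp_defect
  simpa only [ContinuousLinearMap.adjoint_comp, ContinuousLinearMap.adjoint_adjoint,
    adjoint_defect, adjoint_defectStar] using h.symm

theorem IsRowContraction.adjoint_row_mem (hT : IsRowContraction T) (x : DT T) :
    (row T).adjoint (x : H) ∈ DTstar T := by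
  refine map_mem_closure (row T).adjoint.continuous x.2 ?_
  rintro _ ⟨h, rfl⟩
  exact ⟨(row T).adjoint h, (DFunLike.congr_fun hT.adjoint_row_comp_defect h).symm⟩

theorem IsRowContraction.row_mem (hT : IsRowContraction T) (y : DTstar T) :
    row T (y : Copies n H) ∈ DT T := by
  refine map_mem_closure (row T).continuous y.2 ?_
  rintro _ ⟨h, rfl⟩
  exact ⟨row T h, (DFunLike.congr_fun hT.row_comp_defectStar h).symm⟩

/-- `Δ_{T^*}` as an operator from `H^(n)` to `D_{T^*}`. -/
def defectStarTo (T : Fin n → H →L[ℂ] H) : Copies n H →L[ℂ] DTstar T :=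
  (defectStar T).codRestrict (DTstar T)
    (fun h => Submodule.le_topologicalClosure _ (LinearMap.mem_range_self _ h))

/-- The operator `T^*` from `D_T` to `D_{T^*}`; for a row contraction it is a restriction of `T^*`,
since `T^* Δ_T = Δ_{T^*} T^*`. -/
def starTo (T : Fin n → H →L[ℂ] H) : DT T →L[ℂ] DTstar T :=
  (DTstar T).subtypeL.adjoint ∘L (row T).adjoint ∘L (DT T).subtypeL

theorem adjoint_defectTo_apply (T : Fin n → H →L[ℂ] H) (x : DT T) :
    (defectTo T).adjoint x = defect T (x : H) := by
  refine ext_inner_right ℂ fun h => ?_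
  rw [ContinuousLinearMap.adjoint_inner_left, ← adjoint_defect,
    ContinuousLinearMap.adjoint_inner_left]
  rfl

theorem adjoint_defectStarTo_apply (T : Fin n → H →L[ℂ] H) (y : DTstar T) :
    (defectStarTo T).adjoint y = defectStar T (y : Copies n H) := by
  refine ext_inner_right ℂ fun h => ?_
  rw [ContinuousLinearMap.adjoint_inner_left, ← adjoint_defectStar,
    ContinuousLinearMap.adjoint_inner_left]
  rfl

theorem coe_adjoint_subtypeL {E : Type*} [NormedAddCommGroup E] [InnerProductSpace ℂ E]
    [CompleteSpace E] (U : Submodule ℂ E) [CompleteSpace U] {x : E} (hx : x ∈ U) :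
    (U.subtypeL.adjoint x : E) = x := by
  have : U.subtypeL.adjoint x = ⟨x, hx⟩ := ext_inner_right ℂ fun w => by
    rw [ContinuousLinearMap.adjoint_inner_left]; rfl
  rw [this]

theorem IsRowContraction.coe_starTo (hT : IsRowContraction T) (x : DT T) :
    (starTo T x : Copies n H) = (row T).adjoint (x : H) :=
  coe_adjoint_subtypeL _ (hT.adjoint_row_mem x)

theorem IsRowContraction.coe_adjoint_starTo (hT : IsRowContraction T) (y : DTstar T) :
    ((starTo T).adjoint y : H) = row T (y : Copies n H) := by
  rw [starTo, ContinuousLinearMap.adjoint_comp, ContinuousLinearMap.adjoint_comp,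
    ContinuousLinearMap.adjoint_adjoint, ContinuousLinearMap.adjoint_adjoint]
  exact coe_adjoint_subtypeL _ (hT.row_mem y)

/-- The Halmos unitary `[[T, Δ_T], [Δ_{T^*}, -T^*]]`, restricted to `H^(n) ⊕ D_T`. -/
theorem IsRowContraction.isIsometricColligation (hT : IsRowContraction T) :
    IsIsometricColligation T (defectTo T) (defectStarTo T) (starTo T) where
  state := by
    ext1 h
    have h2 := DFunLike.congr_fun hT.defectStar_comp_self h
    rw [add_apply, ContinuousLinearMap.comp_apply, ContinuousLinearMap.comp_apply,
      adjoint_defectStarTo_apply]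
    change _ + (defectStar T ∘L defectStar T) h = h
    rw [h2]
    simp
  input := by
    ext1 x
    refine Subtype.ext ?_
    have h2 := DFunLike.congr_fun hT.defect_comp_self (x : H)
    rw [add_apply, ContinuousLinearMap.comp_apply, ContinuousLinearMap.comp_apply,
      adjoint_defectTo_apply, Submodule.coe_add, hT.coe_adjoint_starTo, hT.coe_starTo]
    change (defect T ∘L defect T) (x : H) + _ = (x : H)
    rw [h2]
    simp
  cross := by
    ext1 x
    rw [ContinuousLinearMap.comp_apply, ContinuousLinearMap.comp_apply, adjoint_defectTo_apply,
      adjoint_defectStarTo_apply, hT.coe_starTo]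
    exact DFunLike.congr_fun hT.adjoint_row_comp_defect (x : H)

end Defect

/-! ### Compression to the constrained space -/

section Commutant

variable {n : ℕ} {J : Submodule ℂ (Fock n →L[ℂ] Fock n)}

/-- The commutant of the left creation operators is the commutant of `F_n^∞`. -/
theorem commute_of_mem_toeplitz {G f : Fock n →L[ℂ] Fock n} (hG : ∀ i, G * S i = S i * G)
    (hf : f ∈ toeplitz n) : G * f = f * G := by
  have hclosed : IsClosed {A : Fock n →WOT[ℂ] Fock n |
      ContinuousLinearMapWOT.ofCLM G * A = A * ContinuousLinearMapWOT.ofCLM G} :=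
    isClosed_eq (continuous_const_mul _) (continuous_mul_const _)
  have hadj : Algebra.adjoin ℂ (Set.range (S : Fin n → Fock n →L[ℂ] Fock n)) ≤
      Subalgebra.centralizer ℂ {G} := by
    refine Algebra.adjoin_le ?_
    rintro _ ⟨i, rfl⟩
    exact Subalgebra.mem_centralizer_iff ℂ |>.mpr fun g hg => by
      rw [Set.mem_singleton_iff.mp hg, hG]
  have hsub := closure_minimal (s := ContinuousLinearMapWOT.ofCLM ''
      (Algebra.adjoin ℂ (Set.range (S : Fin n → Fock n →L[ℂ] Fock n)) :
        Set (Fock n →L[ℂ] Fock n))) (by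
    rintro _ ⟨A, hA, rfl⟩
    exact congrArg ContinuousLinearMapWOT.ofCLM
      (Subalgebra.mem_centralizer_iff ℂ |>.mp (hadj hA) G rfl)) hclosed
  exact ContinuousLinearMapWOT.ofCLM_injective (hsub hf)

theorem S_mem_toeplitz (i : Fin n) : S i ∈ toeplitz n :=
  subset_closure ⟨S i, Algebra.subset_adjoin ⟨i, rfl⟩, rfl⟩

theorem map_mem_MJ {G : Fock n →L[ℂ] Fock n} (h : ∀ f ∈ J, ∀ ξ, G (f ξ) ∈ MJ J) {x : Fock n}
    (hx : x ∈ MJ J) : G x ∈ MJ J := by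
  have hle : MJ J ≤ (MJ J).comap G.toLinearMap := by
    refine Submodule.topologicalClosure_minimal _ (Submodule.span_le.mpr ?_) ?_
    · rintro _ ⟨f, hf, ξ, rfl⟩
      exact h f hf ξ
    · exact (Submodule.isClosed_topologicalClosure _).preimage G.continuous
  exact hle hx

theorem apply_mem_MJ {f : Fock n →L[ℂ] Fock n} (hf : f ∈ J) (ξ : Fock n) : f ξ ∈ MJ J :=
  Submodule.le_topologicalClosure _ (Submodule.subset_span ⟨f, hf, ξ, rfl⟩)

theorem IsWOTClosedIdeal.S_mem_MJ (hJ : IsWOTClosedIdeal J) (i : Fin n) {x : Fock n}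
    (hx : x ∈ MJ J) : S i x ∈ MJ J :=
  map_mem_MJ (fun f hf ξ => apply_mem_MJ (hJ.mul_mem_left _ (S_mem_toeplitz i) f hf) ξ) hx

/-- `M_J = [J F²(H_n)]` is invariant under the commutant of `F_n^∞`. -/
theorem IsWOTClosedIdeal.commutant_mem_MJ (hJ : IsWOTClosedIdeal J) {G : Fock n →L[ℂ] Fock n}
    (hG : ∀ i, G * S i = S i * G) {x : Fock n} (hx : x ∈ MJ J) : G x ∈ MJ J := by
  refine map_mem_MJ (fun f hf ξ => ?_) hx
  have h := DFunLike.congr_fun (commute_of_mem_toeplitz hG (hJ.subset_toeplitz hf)) ξ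
  rw [mul_apply_eq_comp, mul_apply_eq_comp] at h
  rw [h]
  exact apply_mem_MJ hf _

theorem R_comp_S (i j : Fin n) : R (n := n) i * S j = S j * R i :=
  clm_ext_e fun α => by
    rw [mul_apply_eq_comp, mul_apply_eq_comp, S_e, R_e, R_e, S_e, mul_assoc]

theorem PJ_coe (x : NJ J) : PJ J (x : Fock n) = x :=
  Submodule.orthogonalProjectionOnto_mem_subspace_eq_self x

theorem adjoint_PJ : (PJ J).adjoint = (NJ J).subtypeL :=
  Submodule.adjoint_orthogonalProjectionOnto _

theorem PJ_comp_subtypeL : PJ J ∘L (NJ J).subtypeL = .id ℂ _ :=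
  ContinuousLinearMap.ext PJ_coe

/-- For `G` leaving `M_J` invariant, compressing to `N_J` amounts to `P G = (P G|_{N_J}) P`. -/
theorem PJ_apply_eq {G : Fock n →L[ℂ] Fock n} (hG : ∀ x ∈ MJ J, G x ∈ MJ J) (x : Fock n) :
    PJ J (G (PJ J x)) = PJ J (G x) := by
  have : CompleteSpace (MJ J) := (Submodule.isClosed_topologicalClosure _).completeSpace_coe
  have h1 : x - PJ J x ∈ MJ J := by
    rw [← Submodule.orthogonal_orthogonal (MJ J)]
    exact Submodule.sub_starProjection_mem_orthogonal x
  have h2 : PJ J (G (x - PJ J x)) = 0 :=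
    Submodule.orthogonalProjectionOnto_orthogonal_apply_eq_zero (hG _ h1)
  rw [map_sub, map_sub, sub_eq_zero] at h2
  exact h2.symm

theorem IsWOTClosedIdeal.B_comp_PJ (hJ : IsWOTClosedIdeal J) (i : Fin n) :
    B J i ∘L PJ J = PJ J ∘L S i :=
  ContinuousLinearMap.ext (PJ_apply_eq fun _ => hJ.S_mem_MJ i)

theorem IsWOTClosedIdeal.W_comp_PJ (hJ : IsWOTClosedIdeal J) (i : Fin n) :
    W J i ∘L PJ J = PJ J ∘L R i :=
  ContinuousLinearMap.ext (PJ_apply_eq fun _ => hJ.commutant_mem_MJ (R_comp_S i))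

end Commutant

section Compression

variable {n : ℕ} {H X Y L : Type*} [NormedAddCommGroup H] [InnerProductSpace ℂ H]
  [NormedAddCommGroup L] [InnerProductSpace ℂ L]
  [NormedAddCommGroup X] [InnerProductSpace ℂ X] [NormedAddCommGroup Y] [InnerProductSpace ℂ Y]

theorem adjoint_tmulRight_tmul (x x' : X) (ξ : Fock n) :
    (tmulRight (Fock n) x).adjoint (tmul ξ x') = inner ℂ x x' • ξ := by
  refine ext_inner_left ℂ fun η => ?_
  rw [ContinuousLinearMap.adjoint_inner_right, tmulRight_apply, inner_tmul, inner_smul_right,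
    mul_comm]

theorem adjoint_tmulRight_tmap (x : X) (A : Fock n →L[ℂ] Fock n) (u : HTensor (Fock n) X) :
    (tmulRight (Fock n) x).adjoint (tmap A (.id ℂ X) u) =
      A ((tmulRight (Fock n) x).adjoint u) := by
  suffices h : (tmulRight (Fock n) x).adjoint ∘L tmap A (.id ℂ X) =
      A ∘L (tmulRight (Fock n) x).adjoint from DFunLike.congr_fun h u
  refine clm_ext_tmul fun ξ x' => ?_
  simp [tmap_tmul, adjoint_tmulRight_tmul]

/-- A multi-analytic operator `Θ` maps `M_J ⊗ Y` into `M_J ⊗ X`: its matrix entries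
`ξ ↦ ⟪x, Θ (ξ ⊗ y)⟫ ∈ F²(H_n)` commute with `S_1, …, S_n`. -/
theorem IsWOTClosedIdeal.compress_comp {J : Submodule ℂ (Fock n →L[ℂ] Fock n)}
    (hJ : IsWOTClosedIdeal J) (Θ : HTensor (Fock n) Y →L[ℂ] HTensor (Fock n) X)
    (hΘ : ∀ i, Θ ∘L tmap (S i) (.id ℂ Y) = tmap (S i) (.id ℂ X) ∘L Θ) :
    (tmap (PJ J) (.id ℂ X) ∘L Θ ∘L tmap (NJ J).subtypeL (.id ℂ Y)) ∘L tmap (PJ J) (.id ℂ Y) =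
      tmap (PJ J) (.id ℂ X) ∘L Θ := by
  refine clm_ext_tmul fun ξ y => ext_inner_tmul fun η x => ?_
  set G : Fock n →L[ℂ] Fock n := (tmulRight (Fock n) x).adjoint ∘L Θ ∘L tmulRight (Fock n) y
  have hG : ∀ i, G * S i = S i * G := fun i => by
    ext1 ζ
    have h := DFunLike.congr_fun (hΘ i) (tmul ζ y)
    simp only [ContinuousLinearMap.comp_apply, tmap_tmul, ContinuousLinearMap.id_apply] at h
    simp only [mul_apply_eq_comp, G, ContinuousLinearMap.comp_apply, tmulRight_apply, h,
      adjoint_tmulRight_tmap]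
  have key : ∀ u : HTensor (Fock n) X, inner ℂ (tmap (PJ J) (.id ℂ X) u) (tmul η x) =
      inner ℂ (PJ J ((tmulRight (Fock n) x).adjoint u)) η := by
    intro u
    have h : (tmulRight (NJ J) x).adjoint ∘L tmap (PJ J) (.id ℂ X) =
        PJ J ∘L (tmulRight (Fock n) x).adjoint := by
      refine clm_ext_tmul fun ζ x' => ext_inner_left ℂ fun η' => ?_
      simp only [ContinuousLinearMap.comp_apply, ContinuousLinearMap.adjoint_inner_right,
        tmap_tmul, tmulRight_apply, adjoint_tmulRight_tmul, inner_tmul, map_smul,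
        inner_smul_right, ContinuousLinearMap.id_apply]
      ring
    rw [← ContinuousLinearMap.comp_apply, ← h, ContinuousLinearMap.comp_apply,
      ContinuousLinearMap.adjoint_inner_left, tmulRight_apply]
  simp only [ContinuousLinearMap.comp_apply, tmap_tmul, ContinuousLinearMap.id_apply]
  rw [key, key]
  exact congrArg (inner ℂ · η) (PJ_apply_eq (fun _ => hJ.commutant_mem_MJ hG) ξ)

theorem tmap_sum_comm {Q : Fock n →L[ℂ] L} (V : Fin n → L →L[ℂ] L)
    (hV : ∀ i, V i ∘L Q = Q ∘L R i) (A : Fin n → X →L[ℂ] Y) (u : HTensor (Fock n) X) :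
    tmap Q (.id ℂ Y) ((∑ i, tmap (R i) (A i)) u) =
      (∑ i, tmap (V i) (A i)) (tmap Q (.id ℂ X) u) := by
  rw [sum_apply, sum_apply, map_sum]
  refine Finset.sum_congr rfl fun i _ => ?_
  rw [← ContinuousLinearMap.comp_apply, ← ContinuousLinearMap.comp_apply, tmap_comp, tmap_comp,
    hV, ContinuousLinearMap.id_comp, ContinuousLinearMap.comp_id]

variable [CompleteSpace H] [CompleteSpace Y]

/-- If `Q R_i = V_i Q`, then `Q ⊗ I` carries the homogeneous parts of the transfer function into those
built from the `V_i`. -/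
theorem tmap_transferPart (T : Fin n → H →L[ℂ] H) (C : H →L[ℂ] X) (C' : Copies n H →L[ℂ] Y)
    (Q : Fock n →L[ℂ] L) (V : Fin n → L →L[ℂ] L) (hV : ∀ i, V i ∘L Q = Q ∘L R i) (k : ℕ)
    (u : HTensor (Fock n) Y) :
    tmap Q (.id ℂ X) (transferPart T C C' k u) =
      tmap (.id ℂ L) C (((∑ i, tmap (V i) (T i).adjoint) ^ k) ((∑ i, tmap (V i) (coord i))
        (tmap (.id ℂ L) C'.adjoint (tmap Q (.id ℂ Y) u)))) := by
  have hpow : ∀ v, tmap Q (.id ℂ H) ((sumRT T ^ k) v) =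
      ((∑ i, tmap (V i) (T i).adjoint) ^ k) (tmap Q (.id ℂ H) v) := by
    induction k with
    | zero => intro v; rfl
    | succ k ih =>
      intro v
      rw [pow_succ, mul_apply_eq_comp, ih, sumRT, tmap_sum_comm V hV, pow_succ, mul_apply_eq_comp]
  simp only [transferPart, ContinuousLinearMap.comp_apply]
  rw [tmap_id_right_comm, hpow, rowR, tmap_sum_comm V hV, tmap_id_right_comm]

end Compression

/-! ### The constrained characteristic function -/

section CharacteristicFunction

variable {n : ℕ} {H : Type*} [NormedAddCommGroup H] [InnerProductSpace ℂ H] [CompleteSpace H]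
  {T : Fin n → H →L[ℂ] H} {J : Submodule ℂ (Fock n →L[ℂ] Fock n)}

theorem tmap_PJ_subtypeL (X : Type*) [NormedAddCommGroup X] [InnerProductSpace ℂ X] :
    tmap (PJ J) (.id ℂ X) ∘L tmap (NJ J).subtypeL (.id ℂ X) = .id ℂ _ := by
  rw [tmap_comp, PJ_comp_subtypeL, ContinuousLinearMap.comp_id, tmap_id]

/-- The vectors `P_{N_J} e_γ ⊗ x` are total in `N_J ⊗ X`. -/
theorem clm_ext_tmul_PJ_e {X Z : Type*} [NormedAddCommGroup X] [InnerProductSpace ℂ X]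
    [NormedAddCommGroup Z] [InnerProductSpace ℂ Z] {f g : HTensor (NJ J) X →L[ℂ] Z}
    (h : ∀ γ x, f (tmul (PJ J (e γ)) x) = g (tmul (PJ J (e γ)) x)) : f = g := by
  have h1 : f ∘L tmap (PJ J) (.id ℂ X) = g ∘L tmap (PJ J) (.id ℂ X) :=
    clm_ext_tmul_e fun γ x => by simpa [tmap_tmul] using h γ x
  have h2 := congrArg (· ∘L tmap (NJ J).subtypeL (.id ℂ X)) h1
  simpa only [ContinuousLinearMap.comp_assoc, tmap_PJ_subtypeL, ContinuousLinearMap.comp_id]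
    using h2

theorem tmap_subtypeL_injective {E X : Type*} [NormedAddCommGroup E] [InnerProductSpace ℂ E]
    [NormedAddCommGroup X] [InnerProductSpace ℂ X] [CompleteSpace X] (U : Submodule ℂ X)
    [CompleteSpace U] : Function.Injective (tmap (.id ℂ E) U.subtypeL) := by
  have h : tmap (.id ℂ E) U.subtypeL.adjoint ∘L tmap (.id ℂ E) U.subtypeL = .id ℂ _ := by
    rw [tmap_comp, ContinuousLinearMap.comp_id]
    convert tmap_id (E := E) (F := U) using 2
    exact ContinuousLinearMap.ext fun x => Subtype.ext (coe_adjoint_subtypeL U x.2)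
  exact Function.LeftInverse.injective (DFunLike.congr_fun h)

theorem IsCharacteristicFunction.unique
    {Θ Θ' : HTensor (NJ J) (DTstar T) →L[ℂ] HTensor (NJ J) (DT T)}
    (h : IsCharacteristicFunction J T Θ) (h' : IsCharacteristicFunction J T Θ') : Θ = Θ' := by
  refine clm_ext_tmul_PJ_e fun γ d => tmap_subtypeL_injective (DT T) ?_
  obtain ⟨s, hs, h1⟩ := h.fourier γ d
  obtain ⟨s', hs', h1'⟩ := h'.fourier γ d
  rw [h1, h1', hs.unique hs']

theorem IsWOTClosedIdeal.tmap_B_comp {X : Type*} [NormedAddCommGroup X] [InnerProductSpace ℂ X]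
    (hJ : IsWOTClosedIdeal J) (i : Fin n) :
    tmap (B J i) (.id ℂ X) ∘L tmap (PJ J) (.id ℂ X) =
      tmap (PJ J) (.id ℂ X) ∘L tmap (S i) (.id ℂ X) := by
  rw [tmap_comp, tmap_comp, hJ.B_comp_PJ]

/-- If `P, P'` are coisometries with `Θ' P' = P Θ`, then `I - Θ Θ^* = K K^*` passes to
`I - Θ' Θ'^* = (P K) (P K)^*`. -/
theorem sub_comp_adjoint_of_compression {A A' D D' G : Type*}
    [NormedAddCommGroup A] [InnerProductSpace ℂ A] [CompleteSpace A]
    [NormedAddCommGroup A'] [InnerProductSpace ℂ A'] [CompleteSpace A']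
    [NormedAddCommGroup D] [InnerProductSpace ℂ D] [CompleteSpace D]
    [NormedAddCommGroup D'] [InnerProductSpace ℂ D'] [CompleteSpace D']
    [NormedAddCommGroup G] [InnerProductSpace ℂ G] [CompleteSpace G]
    {P : A →L[ℂ] A'} {P' : D →L[ℂ] D'} {Θ : D →L[ℂ] A} {Θ' : D' →L[ℂ] A'} {K : G →L[ℂ] A}
    (hP : P ∘L P.adjoint = .id ℂ _) (hP' : P' ∘L P'.adjoint = .id ℂ _) (h : Θ' ∘L P' = P ∘L Θ)
    (hK : .id ℂ _ - Θ ∘L Θ.adjoint = K ∘L K.adjoint) :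
    .id ℂ _ - Θ' ∘L Θ'.adjoint = (P ∘L K) ∘L (P ∘L K).adjoint := by
  have h1 : Θ' ∘L Θ'.adjoint = P ∘L (Θ ∘L Θ.adjoint) ∘L P.adjoint := by
    calc Θ' ∘L Θ'.adjoint = (Θ' ∘L (P' ∘L P'.adjoint)) ∘L Θ'.adjoint := by
          rw [hP', ContinuousLinearMap.comp_id]
      _ = (Θ' ∘L P') ∘L (Θ' ∘L P').adjoint := by
          simp only [ContinuousLinearMap.adjoint_comp, ContinuousLinearMap.comp_assoc]
      _ = _ := by
          rw [h]
          simp only [ContinuousLinearMap.adjoint_comp, ContinuousLinearMap.comp_assoc]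
  have h2 : Θ ∘L Θ.adjoint = .id ℂ _ - K ∘L K.adjoint := by rw [← hK, sub_sub_cancel]
  rw [h1, h2, ContinuousLinearMap.sub_comp, ContinuousLinearMap.comp_sub,
    ContinuousLinearMap.id_comp, hP, sub_sub_cancel]
  simp only [ContinuousLinearMap.adjoint_comp, ContinuousLinearMap.comp_assoc]

/-- The transfer function of an isometric colligation compresses to `N_J`: the compression is
multi-analytic, has the Fourier series with `W_i` in place of `R_i`, and its defect comes from the
compressed Poisson kernel. -/
theorem IsIsometricColligation.exists_compression {X Y : Type*} [NormedAddCommGroup X]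
    [InnerProductSpace ℂ X] [CompleteSpace X] [NormedAddCommGroup Y] [InnerProductSpace ℂ Y]
    [CompleteSpace Y] {C : H →L[ℂ] X} {C' : Copies n H →L[ℂ] Y} {E : X →L[ℂ] Y}
    (h : IsIsometricColligation T C C' E) (hJ : IsWOTClosedIdeal J) :
    ∃ (Θ : HTensor (NJ J) Y →L[ℂ] HTensor (NJ J) X) (K : H →L[ℂ] HTensor (Fock n) X),
      (∀ i, Θ ∘L tmap (B J i) (.id ℂ Y) = tmap (B J i) (.id ℂ X) ∘L Θ) ∧
      (∀ γ d, HasSum (fun k => tmap (.id ℂ _) C ((sumWT J T ^ k) (rowW J H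
          (tmul (PJ J (e γ)) (C'.adjoint d)))))
        (Θ (tmul (PJ J (e γ)) d) + tmul (PJ J (e γ)) (E.adjoint d))) ∧
      (∀ h, HasSum (fun α => tmul (e α) (C ((wordOp T α).adjoint h))) (K h)) ∧
      .id ℂ _ - Θ ∘L Θ.adjoint =
        (tmap (PJ J) (.id ℂ X) ∘L K) ∘L (tmap (PJ J) (.id ℂ X) ∘L K).adjoint := by
  obtain ⟨Θ, K, hΘK, hK, hΘ⟩ := exists_transferFunction h
  have hS : ∀ i, Θ ∘L tmap (S i) (.id ℂ _) = tmap (S i) (.id ℂ _) ∘L Θ := by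
    refine fun i => clm_ext_tmul_e fun γ d => ?_
    have h1 := (hΘ γ d).mapL (tmap (S i) (.id ℂ _))
    have h2 := hΘ (FreeMonoid.of i * γ) d
    have hterm : ∀ k, tmap (S i) (.id ℂ _) (transferPart T C C' k (tmul (e γ) d)) =
        transferPart T C C' k (tmul (e (FreeMonoid.of i * γ)) d) := by
      intro k
      rw [tmap_transferPart T C C' (S i) R (fun j => R_comp_S j i) k, tmap_tmul, S_e]
      rfl
    simp only [hterm, map_add] at h1
    have h3 := h2.unique h1
    simp only [tmap_tmul, S_e, ContinuousLinearMap.id_apply] at h3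
    simpa only [ContinuousLinearMap.comp_apply, tmap_tmul, S_e, ContinuousLinearMap.id_apply]
      using add_right_cancel h3
  set P := tmap (PJ J) (.id ℂ X) with hP
  set P' := tmap (PJ J) (.id ℂ Y) with hP'
  set ΘJ := P ∘L Θ ∘L tmap (NJ J).subtypeL (.id ℂ Y)
  have hcomp : ΘJ ∘L P' = P ∘L Θ := hJ.compress_comp Θ hS
  have hadj : P.adjoint = tmap (NJ J).subtypeL (.id ℂ X) := by
    rw [hP, adjoint_tmap, adjoint_PJ, ContinuousLinearMap.adjoint_id]
  have hadj' : P'.adjoint = tmap (NJ J).subtypeL (.id ℂ Y) := by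
    rw [hP', adjoint_tmap, adjoint_PJ, ContinuousLinearMap.adjoint_id]
  have hPP : P ∘L P.adjoint = .id ℂ _ := by rw [hadj, hP, tmap_PJ_subtypeL]
  have hPP' : P' ∘L P'.adjoint = .id ℂ _ := by rw [hadj', hP', tmap_PJ_subtypeL]
  refine ⟨ΘJ, K, fun i => ?_, fun γ d => ?_, hK, ?_⟩
  · -- `P'` has a right inverse, so it is enough to compare after composition with it
    have h : (ΘJ ∘L tmap (B J i) (.id ℂ _)) ∘L P' = (tmap (B J i) (.id ℂ _) ∘L ΘJ) ∘L P' := by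
      rw [ContinuousLinearMap.comp_assoc, hJ.tmap_B_comp, ← ContinuousLinearMap.comp_assoc, hcomp,
        ContinuousLinearMap.comp_assoc, hS, ContinuousLinearMap.comp_assoc, hcomp,
        ← ContinuousLinearMap.comp_assoc, ← hJ.tmap_B_comp, ContinuousLinearMap.comp_assoc]
    have h2 := congrArg (· ∘L P'.adjoint) h
    simpa only [ContinuousLinearMap.comp_assoc, hPP', ContinuousLinearMap.comp_id] using h2
  · have h1 := (hΘ γ d).mapL P
    have hterm : ∀ k, P (transferPart T C C' k (tmul (e γ) d)) =
        tmap (.id ℂ _) C ((sumWT J T ^ k) (rowW J H (tmul (PJ J (e γ)) (C'.adjoint d)))) := by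
      intro k
      rw [hP, tmap_transferPart T C C' (PJ J) (W J) hJ.W_comp_PJ k, tmap_tmul, tmap_tmul]
      rfl
    have hΘJe : ΘJ (tmul (PJ J (e γ)) d) = P (Θ (tmul (e γ) d)) := by
      have h := DFunLike.congr_fun hcomp (tmul (e γ) d)
      simpa only [ContinuousLinearMap.comp_apply, hP', tmap_tmul, ContinuousLinearMap.id_apply]
        using h
    have hE : P (tmap (.id ℂ _) E.adjoint (tmul (e γ) d)) = tmul (PJ J (e γ)) (E.adjoint d) := by
      simp only [hP, tmap_tmul, ContinuousLinearMap.id_apply]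
    simpa only [hterm, map_add, hE, ← hΘJe] using h1
  · exact sub_comp_adjoint_of_compression hPP hPP' hcomp hΘK

theorem exists_characteristicFunction (hJ : IsWOTClosedIdeal J) (hT : IsRowContraction T) :
    ∃ Θ K, IsCharacteristicFunction J T Θ ∧ IsPoissonKernel T K ∧
      .id ℂ (HTensor (NJ J) (DT T)) - Θ ∘L Θ.adjoint =
        constrainedKernel J T K ∘L (constrainedKernel J T K).adjoint := by
  obtain ⟨Θ, K, hB, hΘ, hK, hΘK⟩ := hT.isIsometricColligation.exists_compression hJ
  refine ⟨Θ, K, ⟨hB, fun γ d => ?_⟩, hK, hΘK⟩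
  have h1 := (hΘ γ d).mapL (tmap (.id ℂ (NJ J)) (DT T).subtypeL)
  have hι : ∀ u, tmap (.id ℂ (NJ J)) (DT T).subtypeL (tmap (.id ℂ (NJ J)) (defectTo T) u) =
      tmap (.id ℂ (NJ J)) (defect T) u := fun u => by
    rw [← ContinuousLinearMap.comp_apply, tmap_comp]
    rfl
  rw [map_add, tmap_tmul _ _ _ ((starTo T).adjoint d), Submodule.subtypeL_apply,
    hT.coe_adjoint_starTo] at h1
  simp only [hι, adjoint_defectStarTo_apply] at h1
  have h2 : ∀ k, fourierPart J T k (tmul (PJ J (e γ)) (d : Copies n H)) =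
      tmap (.id ℂ (NJ J)) (defect T) ((sumWT J T ^ k) (rowW J H
        (tmul (PJ J (e γ)) (defectStar T (d : Copies n H))))) := fun k => by
    simp only [fourierPart, ContinuousLinearMap.comp_apply, tmap_tmul,
      ContinuousLinearMap.id_apply]
  simp only [← h2] at h1
  refine ⟨_, h1, eq_neg_add_of_add_eq ?_⟩
  rw [tmap_tmul, add_comm, ContinuousLinearMap.id_apply]

end CharacteristicFunction

end NCFock
end

open NCFock in
theorem theorem2p1 {n : ℕ} (hn : 1 ≤ n)
    {H : Type*} [NormedAddCommGroup H] [InnerProductSpace ℂ H] [CompleteSpace H]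
    (J : Submodule ℂ (Fock n →L[ℂ] Fock n)) (hJ : IsWOTClosedIdeal J)
    (hJ' : (J : Set (Fock n →L[ℂ] Fock n)) ≠ toeplitz n)
    (T : Fin n → H →L[ℂ] H) (hT : IsRowContraction T) (hcnc : IsCNC T)
    (hJT : IsConstrained J T) :
    (∃! Θ, IsCharacteristicFunction J T Θ) ∧ (∃! K, IsPoissonKernel T K) ∧
    ∀ (Θ : HTensor (NJ J) (DTstar T) →L[ℂ] HTensor (NJ J) (DT T))
      (K : H →L[ℂ] HTensor (Fock n) (DT T)),
      IsCharacteristicFunction J T Θ → IsPoissonKernel T K →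
      ContinuousLinearMap.id ℂ (HTensor (NJ J) (DT T)) - Θ ∘L Θ.adjoint =
        constrainedKernel J T K ∘L (constrainedKernel J T K).adjoint := by
  obtain ⟨Θ, K, hΘ, hK, hΘK⟩ := exists_characteristicFunction hJ hT
  have hKuniq : ∀ K', IsPoissonKernel T K' → K' = K := fun K' hK' =>
    ContinuousLinearMap.ext fun h => (hK' h).unique (hK h)
  refine ⟨⟨Θ, hΘ, fun Θ' hΘ' => hΘ'.unique hΘ⟩, ⟨K, hK, hKuniq⟩, fun Θ' K' hΘ' hK' => ?_⟩
  rw [hΘ'.unique hΘ, hKuniq K' hK', hΘK]
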